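/- All graphs are finite, simple, undirected and connected. A graph is cubic if every vertex has degree $3$, and bridgeless if no edge is a bridge. A cubic graph is Tait-colorable if its edge set can be partitioned into three perfect matchings; a snark is a bridgeless cubic graph that is not Tait-colorable. For a graph $G=(V,E)$ that admits a perfect matching put $$\eta(G)=\min_{w}\frac{\max\{w(P): P \text{ a perfect matching of } G\}}{\max\{w(M): M\text{ a matching of } G\}},$$ where $w$ ranges over all functions $w:E\to[0,\infty)$ that are not identically zero and $w(F)=\sum_{e\in F}w(e)$. For a class $\mathcal G$ of graphs that admit perfect matchings put $\eta(\mathcal G)=\inf_{G\in\mathcal G}\eta(G)$. For $n\ge 3$ and $1\le k\le\lfloor (n-1)/2\rfloor$ the generalized Petersen graph $G(n,k)$ has vertices $u_i,v_i$ ($i\in\mathbb Z/n$) and edges $u_iu_{i+1}$, $u_iv_i$, $v_iv_{i+k}$; the Petersen graph is $R=G(5,2)$. Let $\mathcal S$ be the family of graphs $G$, each with a matching $M_G$, obtained recursively as follows, up to isomorphism. The Petersen graph $R$ with the matching $M_R=\{u_1v_1,u_3u_4,v_0v_2\}$ is in $\mathcal S$. If $H_1,H_2$ with matchings $M_{H_1},M_{H_2}$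 are (disjoint copies of) members of $\mathcal S$, and $uv\notin M_{H_1}$ is an edge of $H_1$ and $xy\notin M_{H_2}$ an edge of $H_2$ such that $u$ and $x$ are saturated by $M_{H_1}$ and $M_{H_2}$, respectively, while $v$ and $y$ are not, then the graph obtained from $H_1-uv$ and $H_2-xy$ by adding the edges $uy$ and $vx$, with the matching $M_{H_1}\cup M_{H_2}$, is in $\mathcal S$. **Theorem.** 1. Each of the following classes satisfies $\eta=1/3$, and the infimum is attained: the Tait-colorable graphs; the planar bridgeless cubic graphs; the hamiltonian cubic graphs; the generalized Petersen graphs. 2. $\mathcal S$ contains graphs of arbitrarily large order, and every member $G$ of $\mathcal S$ is a snark with $\eta(G)=1/3$; in particular $\eta(\mathcal S)=1/3$. 3. Every bipartite nonhamiltonian cubic graph is Tait-colorable, and the class $\mathcal B$ of these graphs satisfies $1/3\le\eta(\mathcal B)\le 1/2$; moreover some $G\in\mathcal B$ has $\eta(G)\le 1/2$. -/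

import Mathlib

open scoped NNReal

noncomputable section

/-- A finite simple undirected graph. -/
structure FinGraph where
  V : Type
  [fintype : Fintype V]
  [decEq : DecidableEq V]
  graph : SimpleGraph V

attribute [instance] FinGraph.fintype FinGraph.decEq

namespace CostOfPerfection

section Eta

variable {V : Type} (G : SimpleGraph V)

/-- The total weight of the edges of a subgraph `M`. -/
def weight (w : G.edgeSet → ℝ≥0) (M : G.Subgraph) : ℝ :=
  ∑ᶠ e ∈ {e : G.edgeSet | (e : Sym2 V) ∈ M.edgeSet}, (w e : ℝ)

/-- The weight of a maximum weight matching. -/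
def maxMatchingWeight (w : G.edgeSet → ℝ≥0) : ℝ :=
  sSup (weight G w '' {M | M.IsMatching})

/-- The weight of a maximum weight perfect matching. -/
def maxPerfectMatchingWeight (w : G.edgeSet → ℝ≥0) : ℝ :=
  sSup (weight G w '' {P | P.IsPerfectMatching})

/-- The ratios `w(P*) / w(M*)`, over all nonnegative weights that are not identically zero. -/
def ratios : Set ℝ :=
  {r | ∃ w : G.edgeSet → ℝ≥0, w ≠ 0 ∧
    r = maxPerfectMatchingWeight G w / maxMatchingWeight G w}

/-- The parameter `η(G)`. The infimum is a minimum as soon as `G` has an edge, see `eta_isLeast`. -/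
def eta : ℝ := sInf (ratios G)

/-- A maximum weight matching exists. -/
theorem maxMatchingWeight_isGreatest [Finite V] (w : G.edgeSet → ℝ≥0) :
    IsGreatest (weight G w '' {M | M.IsMatching}) (maxMatchingWeight G w) := by
  have hfin : (weight G w '' {M : G.Subgraph | M.IsMatching}).Finite := Set.toFinite _
  refine hfin.isCompact.isGreatest_sSup ⟨_, ⊥, ?_, rfl⟩
  intro v hv
  exact absurd hv (by simp)

/-- A maximum weight perfect matching exists if there is a perfect matching. -/
theorem maxPerfectMatchingWeight_isGreatest [Finite V] (w : G.edgeSet → ℝ≥0)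
    (h : ∃ P : G.Subgraph, P.IsPerfectMatching) :
    IsGreatest (weight G w '' {P | P.IsPerfectMatching}) (maxPerfectMatchingWeight G w) := by
  have hfin : (weight G w '' {M : G.Subgraph | M.IsPerfectMatching}).Finite := Set.toFinite _
  obtain ⟨P, hP⟩ := h
  exact hfin.isCompact.isGreatest_sSup ⟨_, P, hP, rfl⟩

theorem weight_smul [Finite V] (c : ℝ≥0) (w : G.edgeSet → ℝ≥0) (M : G.Subgraph) :
    weight G (c • w) M = c * weight G w M := by
  unfold weight
  rw [finsum_mem_eq_finite_toFinset_sum _ (Set.toFinite _),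
    finsum_mem_eq_finite_toFinset_sum _ (Set.toFinite _), Finset.mul_sum]
  simp

theorem continuous_weight [Finite V] (M : G.Subgraph) :
    Continuous fun w : G.edgeSet → ℝ≥0 => weight G w M := by
  unfold weight
  simp_rw [finsum_mem_eq_finite_toFinset_sum _ (Set.toFinite _)]
  fun_prop

theorem sSup_weight_smul [Finite V] (c : ℝ≥0) (w : G.edgeSet → ℝ≥0) (S : Set G.Subgraph) :
    sSup (weight G (c • w) '' S) = c * sSup (weight G w '' S) := by
  have := Real.sSup_smul_of_nonneg (a := (c : ℝ)) c.2 (weight G w '' S)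
  rw [smul_eq_mul] at this
  rw [← this]
  congr 1
  ext r
  simp [Set.mem_smul_set, weight_smul]

theorem continuous_sSup_weight [Finite V] (S : Set G.Subgraph) :
    Continuous fun w : G.edgeSet → ℝ≥0 => sSup (weight G w '' S) := by
  rcases S.eq_empty_or_nonempty with rfl | hS
  · simpa using continuous_const
  · have hfin : S.Finite := Set.toFinite _
    have hne : hfin.toFinset.Nonempty := by simpa using hS
    have : (fun w : G.edgeSet → ℝ≥0 => sSup (weight G w '' S)) =
        fun w => hfin.toFinset.sup' hne (fun M => weight G w M) := by
      funext w
      rw [Finset.sup'_eq_csSup_image]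
      simp
    rw [this]
    exact Continuous.finset_sup'_apply hne fun M _ => continuous_weight G M

theorem maxMatchingWeight_pos [Finite V] (w : G.edgeSet → ℝ≥0) (hw : w ≠ 0) :
    0 < maxMatchingWeight G w := by
  obtain ⟨e, he⟩ := Function.ne_iff.mp hw
  obtain ⟨e, hmem⟩ := e
  induction e with
  | h u v =>
    have huv : G.Adj u v := hmem
    refine lt_of_lt_of_le ?_ ((maxMatchingWeight_isGreatest G w).2
      ⟨G.subgraphOfAdj huv, SimpleGraph.Subgraph.IsMatching.subgraphOfAdj huv, rfl⟩)
    unfold weight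
    rw [finsum_mem_eq_finite_toFinset_sum _ (Set.toFinite _)]
    refine Finset.sum_pos' (fun _ _ => NNReal.coe_nonneg _) ⟨⟨s(u, v), hmem⟩, by simp, ?_⟩
    exact NNReal.coe_pos.mpr (pos_iff_ne_zero.mpr he)

/-- For a finite graph with at least one edge the minimum defining `η(G)` is attained. -/
theorem eta_isLeast [Finite V] (h : G.edgeSet.Nonempty) : IsLeast (ratios G) (eta G) := by
  have := Fintype.ofFinite G.edgeSet
  let f : (G.edgeSet → ℝ≥0) → ℝ :=
    fun w => maxPerfectMatchingWeight G w / maxMatchingWeight G w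
  let K : Set (G.edgeSet → ℝ≥0) := {w | ∑ e, w e = 1}
  have hK0 : ∀ w ∈ K, w ≠ 0 := by
    rintro w hw rfl
    simp [K] at hw
  have hKc : IsCompact K := by
    refine IsCompact.of_isClosed_subset
      (isCompact_univ_pi fun _ : G.edgeSet => isCompact_Icc (a := (0 : ℝ≥0)) (b := 1)) ?_ ?_
    · exact isClosed_eq (by fun_prop) continuous_const
    · intro w hw e _
      refine ⟨zero_le, ?_⟩
      rw [← show ∑ e, w e = 1 from hw]
      exact Finset.single_le_sum (fun _ _ => zero_le) (Finset.mem_univ e)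
  have hKn : K.Nonempty := by
    classical
    obtain ⟨e, he⟩ := h
    exact ⟨Pi.single ⟨e, he⟩ 1, by simp [K]⟩
  have hfc : ContinuousOn f K := by
    refine ContinuousOn.div (continuous_sSup_weight G _).continuousOn
      (continuous_sSup_weight G _).continuousOn ?_
    intro w hw
    exact (maxMatchingWeight_pos G w (hK0 w hw)).ne'
  have himg : ratios G = f '' K := by
    ext r
    constructor
    · rintro ⟨w, hw, rfl⟩
      have hs : ∑ e, w e ≠ 0 := by
        intro h0
        apply hw
        funext e
        simpa using (Finset.sum_eq_zero_iff.mp h0) e (Finset.mem_univ e)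
      refine ⟨(∑ e, w e)⁻¹ • w, ?_, ?_⟩
      · change ∑ e, ((∑ e, w e)⁻¹ • w) e = 1
        simp only [Pi.smul_apply, smul_eq_mul, ← Finset.mul_sum]
        exact inv_mul_cancel₀ hs
      · have hc : (((∑ e, w e)⁻¹ : ℝ≥0) : ℝ) ≠ 0 := by
          exact_mod_cast inv_ne_zero hs
        simp only [f, maxPerfectMatchingWeight, maxMatchingWeight, sSup_weight_smul]
        exact mul_div_mul_left _ _ hc
    · rintro ⟨w, hw, rfl⟩
      exact ⟨w, hK0 w hw, rfl⟩
  unfold eta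
  rw [himg]
  exact (hKc.image_of_continuousOn hfc).isLeast_sInf (hKn.image f)

end Eta

/-- The parameter `η` of a graph class: the infimum of `η(G)` over its members. -/
def classEta (C : Set FinGraph) : ℝ := sInf ((fun G : FinGraph => eta G.graph) '' C)

section Properties

variable {V : Type}

/-- A connected graph all of whose vertices have degree exactly three. -/
def IsConnectedCubic (G : SimpleGraph V) : Prop :=
  G.Connected ∧ ∀ v, (G.neighborSet v).ncard = 3

/-- No edge of the graph is a bridge. -/
def IsBridgeless (G : SimpleGraph V) : Prop := ∀ e ∈ G.edgeSet, ¬ G.IsBridge e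

/-- A connected cubic graph whose edges are partitioned into three perfect matchings. -/
def IsTaitColorable (G : SimpleGraph V) : Prop :=
  IsConnectedCubic G ∧ ∃ P : Fin 3 → G.Subgraph,
    (∀ i, (P i).IsPerfectMatching) ∧ ∀ e ∈ G.edgeSet, ∃! i, e ∈ (P i).edgeSet

/-- A snark: a connected bridgeless cubic graph that is not Tait-colorable. -/
def IsSnark (G : SimpleGraph V) : Prop :=
  IsConnectedCubic G ∧ IsBridgeless G ∧ ¬ IsTaitColorable G

/-- A drawing of a graph in the plane without crossings: vertices are distinct points, each edge
is a simple arc between its two ends, the interior of an arc contains no vertex, and the interiors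
of two distinct arcs are disjoint. -/
structure PlaneDrawing (G : SimpleGraph V) where
  pos : V → ℝ × ℝ
  pos_injective : Function.Injective pos
  arc : G.edgeSet → unitInterval → ℝ × ℝ
  arc_continuous : ∀ e, Continuous (arc e)
  arc_injective : ∀ e, Function.Injective (arc e)
  arc_ends : ∀ e : G.edgeSet, ∃ u v, (e : Sym2 V) = s(u, v) ∧ arc e 0 = pos u ∧ arc e 1 = pos v
  arc_ne_pos : ∀ e, ∀ t ∈ Set.Ioo (0 : unitInterval) 1, ∀ v, arc e t ≠ pos v
  arc_ne_arc : ∀ e f, e ≠ f → ∀ s ∈ Set.Ioo (0 : unitInterval) 1,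
    ∀ t ∈ Set.Ioo (0 : unitInterval) 1, arc e s ≠ arc f t

/-- A graph is planar if it has a plane drawing without crossings. -/
def IsPlanar (G : SimpleGraph V) : Prop := Nonempty (PlaneDrawing G)

end Properties

/-- The generalized Petersen graph `G(n, k)`, with `u i = Sum.inl i` and `v i = Sum.inr i`: its
edges are `u i – u (i + 1)`, `u i – v i` and `v i – v (i + k)`, with subscripts modulo `n`. -/
def genPetersen (n k : ℕ) : SimpleGraph (ZMod n ⊕ ZMod n) :=
  SimpleGraph.fromRel fun a b =>
    (∃ i, a = .inl i ∧ b = .inl (i + 1)) ∨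
    (∃ i, a = .inl i ∧ b = .inr i) ∨
    (∃ i, a = .inr i ∧ b = .inr (i + k))

/-- The Petersen graph `G(5, 2)`. -/
def petersen : SimpleGraph (ZMod 5 ⊕ ZMod 5) := genPetersen 5 2

/-- A maximal matching of the Petersen graph with three edges. The four vertices it leaves
unsaturated form an independent set; up to automorphism it is the only such matching. -/
def petersenMatching : Set (Sym2 (ZMod 5 ⊕ ZMod 5)) :=
  {s(.inl 1, .inr 1), s(.inl 3, .inl 4), s(.inr 0, .inr 2)}

/-- The vertex `v` is an end of an edge of `M`. -/
def Saturates {V : Type} (M : Set (Sym2 V)) (v : V) : Prop := ∃ e ∈ M, v ∈ e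

/-- Delete `uv` from `H₁` and `xy` from `H₂`, and join `u` with `y` and `v` with `x` in the
disjoint union. -/
def edgeJoin {V W : Type} (H₁ : SimpleGraph V) (H₂ : SimpleGraph W) (u v : V) (x y : W) :
    SimpleGraph (V ⊕ W) :=
  (H₁.deleteEdges {s(u, v)}).sum (H₂.deleteEdges {s(x, y)}) ⊔
    SimpleGraph.edge (.inl u) (.inr y) ⊔ SimpleGraph.edge (.inl v) (.inr x)

/-- The pairs `(G, M)` of a graph and a matching in it that are constructed from the Petersen
graph with its matching by repeatedly joining two constructed pairs along edges `uv`, `xy`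
outside the matchings, where `u`, `x` are saturated and `v`, `y` are not. -/
inductive Constructed : ∀ {V : Type}, SimpleGraph V → Set (Sym2 V) → Prop
  | base : Constructed petersen petersenMatching
  | join {V W : Type} {H₁ : SimpleGraph V} {H₂ : SimpleGraph W}
      {M₁ : Set (Sym2 V)} {M₂ : Set (Sym2 W)} {u v : V} {x y : W} :
      Constructed H₁ M₁ → Constructed H₂ M₂ →
      H₁.Adj u v → s(u, v) ∉ M₁ → Saturates M₁ u → ¬ Saturates M₁ v →
      H₂.Adj x y → s(x, y) ∉ M₂ → Saturates M₂ x → ¬ Saturates M₂ y →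
      Constructed (edgeJoin H₁ H₂ u v x y)
        (Sym2.map Sum.inl '' M₁ ∪ Sym2.map Sum.inr '' M₂)

/-- Tait-colorable graphs. -/
def taitColorableGraphs : Set FinGraph := {G | IsTaitColorable G.graph}

/-- Planar bridgeless cubic graphs. -/
def planarBridgelessCubicGraphs : Set FinGraph :=
  {G | IsConnectedCubic G.graph ∧ IsBridgeless G.graph ∧ IsPlanar G.graph}

/-- Hamiltonian cubic graphs. -/
def hamiltonianCubicGraphs : Set FinGraph :=
  {G | IsConnectedCubic G.graph ∧ G.graph.IsHamiltonian}

/-- Generalized Petersen graphs, up to isomorphism. -/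
def generalizedPetersenGraphs : Set FinGraph :=
  {G | ∃ n k : ℕ, 3 ≤ n ∧ 1 ≤ k ∧ k ≤ (n - 1) / 2 ∧ Nonempty (G.graph ≃g genPetersen n k)}

/-- The graphs constructed from the Petersen graph, up to isomorphism. -/
def petersenSnarkFamily : Set FinGraph :=
  {G | ∃ (V : Type) (H : SimpleGraph V) (M : Set (Sym2 V)),
    Constructed H M ∧ Nonempty (G.graph ≃g H)}

/-- Bipartite nonhamiltonian cubic graphs. -/
def bipartiteNonhamiltonianCubicGraphs : Set FinGraph :=
  {G | IsConnectedCubic G.graph ∧ G.graph.IsBipartite ∧ ¬ G.graph.IsHamiltonian}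

/-- `η(C) = r`, and the minimum over the class is attained. -/
def ClassEtaEq (C : Set FinGraph) (r : ℝ) : Prop :=
  classEta C = r ∧ IsLeast ((fun G : FinGraph => eta G.graph) '' C) r

end CostOfPerfection

end

/-!
If `G` is cubic and bridgeless, then by parity every odd cut has at least three edges, so the vector
with all entries `1 / 3` lies in Edmonds' perfect matching polytope. A convex combination of perfect
matchings thus has one third of the total weight, and some perfect matching has at least that much:
`η(G) ≥ 1 / 3`.

For the upper bound let `M` be a maximal matching that covers `3 / 5` of the vertices. The uncovered
vertices are independent, so a perfect matching `P` matches them with covered ones; hence at most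
`1 / 5` of the vertices lie on edges of `M ∩ P`, one third of those on edges of `M`, and the
indicator weight of `M` gives `η(G) ≤ 1 / 3`. Such matchings survive joining two graphs by an
exchange of edges, and so does the absence of a Tait colouring: each colour class meets the cut of
two new edges in an even number of edges, so these have the same colour, and the colouring restricts
to both parts.

The bipartite nonhamiltonian example links two vertices by three copies of `K₃,₃` minus an edge. A
perfect matching that enters a copy must leave it at its other end, so no perfect matching contains
both edges of a suitable matching of size two, and the complement of a perfect matching is
disconnected.
-/

open scoped Finset

universe u

noncomputable section

namespace CostOfPerfection

section Pairing

variable {V : Type*}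

/-- A fixed-point-free involution. It encodes a perfect matching of the complete graph on `V`:
the partner of `v` is `σ v`. -/
structure IsPairing (σ : V → V) : Prop where
  involutive : Function.Involutive σ
  ne : ∀ v, σ v ≠ v

theorem IsPairing.even_card_filter_mem [DecidableEq V] {σ : V → V} (hσ : IsPairing σ)
    (A : Finset V) : Even #{a ∈ A | σ a ∈ A} := by
  rw [← ZMod.natCast_eq_zero_iff_even, Finset.cast_card]
  refine Finset.sum_involution (fun a _ => σ a) (fun _ _ => by decide) (fun a _ _ => hσ.ne a)
    (fun a ha => ?_) (fun a _ => hσ.involutive a)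
  simp only [Finset.mem_filter] at ha ⊢
  exact ⟨ha.2, (hσ.involutive a).symm ▸ ha.1⟩

theorem IsPairing.exists_mem_notMem {σ : V → V} (hσ : IsPairing σ) {A : Finset V}
    (hA : Odd #A) : ∃ a ∈ A, σ a ∉ A := by
  classical
  by_contra! h
  have heven := hσ.even_card_filter_mem A
  rw [Finset.filter_eq_self.mpr h] at heven
  exact Nat.not_even_iff_odd.mpr hA heven

end Pairing

section Cut

variable {V : Type*} [Fintype V] [DecidableEq V]

/-- The total value of the pairs that leave `A`. -/
def cut (x : V → V → ℝ) (A : Finset V) : ℝ := ∑ a ∈ A, ∑ b ∈ Aᶜ, x a b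

theorem cut_compl {x : V → V → ℝ} (hx : ∀ a b, x a b = x b a) (A : Finset V) :
    cut x Aᶜ = cut x A := by
  unfold cut
  rw [compl_compl, Finset.sum_comm]
  simp_rw [hx]

theorem cut_singleton {x : V → V → ℝ} (hx : ∀ a, x a a = 0) (a : V) :
    cut x {a} = ∑ b, x a b := by
  rw [cut, Finset.sum_singleton, ← Finset.sum_add_sum_compl {a} (fun b => x a b)]
  simp [hx]

theorem cut_smul_add_smul (s t : ℝ) (x y : V → V → ℝ) (A : Finset V) :
    cut (s • x + t • y) A = s * cut x A + t * cut y A := by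
  simp [cut, Finset.sum_add_distrib, Finset.mul_sum]

@[fun_prop]
theorem continuous_cut (A : Finset V) : Continuous fun x : V → V → ℝ => cut x A := by
  unfold cut
  fun_prop

/-- Edmonds' description of the perfect matching polytope of the complete graph on `V`:
nonnegative edge values that sum to one around every vertex and to at least one across every odd
cut. An edge vector is encoded as a symmetric function on `V × V` that vanishes on the
diagonal. -/
structure EdmondsConstraints (x : V → V → ℝ) : Prop where
  nonneg : ∀ a b, 0 ≤ x a b
  symm : ∀ a b, x a b = x b a
  diag : ∀ a, x a a = 0
  sum_row : ∀ a, ∑ b, x a b = 1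
  one_le_cut : ∀ A : Finset V, Odd #A → 1 ≤ cut x A

namespace EdmondsConstraints

variable {x : V → V → ℝ}

theorem cut_singleton_eq_one (hx : EdmondsConstraints x) (a : V) : cut x {a} = 1 := by
  rw [cut_singleton hx.diag, hx.sum_row]

theorem le_one (hx : EdmondsConstraints x) (a b : V) : x a b ≤ 1 :=
  hx.sum_row a ▸ Finset.single_le_sum (fun c _ => hx.nonneg a c) (Finset.mem_univ b)

theorem even_card (hx : EdmondsConstraints x) : Even (Fintype.card V) := by
  by_contra hodd
  have h := hx.one_le_cut Finset.univ (Nat.not_even_iff_odd.mp hodd)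
  simp [cut] at h
  linarith

theorem one_le_sum_of_support_subset (hx : EdmondsConstraints x) {A B : Finset V} (hA : Odd #A)
    (hAB : ∀ a ∈ A, ∀ b ∉ A, x a b ≠ 0 → b ∈ B) : 1 ≤ ∑ a ∈ A, ∑ b ∈ B, x a b := by
  refine (hx.one_le_cut A hA).trans (Finset.sum_le_sum fun a ha => ?_)
  calc ∑ b ∈ Aᶜ, x a b = ∑ b ∈ Aᶜ with b ∈ B, x a b :=
        (Finset.sum_filter_of_ne fun b hb hne => hAB a ha b (Finset.mem_compl.mp hb) hne).symm
    _ ≤ ∑ b ∈ B, x a b :=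
        Finset.sum_le_sum_of_subset_of_nonneg (fun b hb => (Finset.mem_filter.mp hb).2)
          fun b _ _ => hx.nonneg a b

end EdmondsConstraints

/-- The graph of the pairs with a nonzero value. -/
def supportGraph (x : V → V → ℝ) : SimpleGraph V := SimpleGraph.fromRel fun a b => x a b ≠ 0

namespace EdmondsConstraints

variable {x : V → V → ℝ}

theorem supportGraph_adj (hx : EdmondsConstraints x) {a b : V} :
    (supportGraph x).Adj a b ↔ x a b ≠ 0 := by
  simp only [supportGraph, SimpleGraph.fromRel_adj, hx.symm b a, or_self, and_iff_right_iff_imp]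
  rintro h rfl
  exact h (hx.diag a)

theorem one_le_sum_oddComponent (hx : EdmondsConstraints x) (u : Finset V)
    {C : ((⊤ : (supportGraph x).Subgraph).deleteVerts (u : Set V)).coe.ConnectedComponent}
    (hC : Odd C.supp.ncard) :
    1 ≤ ∑ a ∈ (C.supp.toFinite.toFinset).map (Function.Embedding.subtype _), ∑ b ∈ u, x a b := by
  refine hx.one_le_sum_of_support_subset
    (by rwa [Finset.card_map, ← Set.ncard_eq_toFinset_card]) fun a ha b hb hab => ?_
  simp only [Finset.mem_map, Set.Finite.mem_toFinset, Function.Embedding.subtype_apply,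
    Subtype.exists, exists_and_right, exists_eq_right] at ha hb
  obtain ⟨hau, haC⟩ := ha
  by_contra hbu
  refine hb ⟨by simpa using hbu, C.mem_supp_of_adj_mem_supp haC ?_⟩
  have hau' : a ∉ u := by simpa using hau
  simp [hx.supportGraph_adj, hab, hau', hbu]

/-- The odd components of the support without `u` send disjoint amounts of value at least one
into `u`, and `u` receives its cardinality. -/
theorem ncard_oddComponents_le (hx : EdmondsConstraints x) (u : Finset V) :
    ((⊤ : (supportGraph x).Subgraph).deleteVerts (u : Set V)).coe.oddComponents.ncard ≤ #u := by
  set H := ((⊤ : (supportGraph x).Subgraph).deleteVerts (u : Set V)).coe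
  have hfin : H.oddComponents.Finite := Set.toFinite _
  let A (C : H.ConnectedComponent) : Finset V :=
    (C.supp.toFinite.toFinset).map (Function.Embedding.subtype _)
  have hdisj : (hfin.toFinset : Set H.ConnectedComponent).PairwiseDisjoint A := by
    intro _ _ _ _ hCD
    refine (Finset.disjoint_map _).mpr ?_
    simpa using SimpleGraph.pairwise_disjoint_supp_connectedComponent H hCD
  rw [Set.ncard_eq_toFinset_card _ hfin, ← Nat.cast_le (α := ℝ)]
  calc (#hfin.toFinset : ℝ) = ∑ _C ∈ hfin.toFinset, (1 : ℝ) := by simp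
    _ ≤ ∑ C ∈ hfin.toFinset, ∑ a ∈ A C, ∑ b ∈ u, x a b :=
        Finset.sum_le_sum fun _ hC => hx.one_le_sum_oddComponent u (by simpa using hC)
    _ = ∑ a ∈ hfin.toFinset.biUnion A, ∑ b ∈ u, x a b := (Finset.sum_biUnion hdisj).symm
    _ ≤ ∑ a, ∑ b ∈ u, x a b :=
        Finset.sum_le_sum_of_subset_of_nonneg (Finset.subset_univ _) fun a _ _ =>
          Finset.sum_nonneg fun b _ => hx.nonneg a b
    _ = ∑ b ∈ u, ∑ a, x b a := by
        rw [Finset.sum_comm]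
        exact Finset.sum_congr rfl fun b _ => Finset.sum_congr rfl fun a _ => hx.symm a b
    _ = #u := by simp [hx.sum_row]

theorem exists_isPairing_in_support (hx : EdmondsConstraints x) :
    ∃ σ : V → V, IsPairing σ ∧ ∀ v, x v (σ v) ≠ 0 := by
  obtain ⟨M, hM⟩ : ∃ M : (supportGraph x).Subgraph, M.IsPerfectMatching := by
    refine SimpleGraph.tutte.mpr fun u => not_lt.mpr ?_
    lift u to Finset V using u.toFinite
    exact (hx.ncard_oddComponents_le u).trans_eq (Set.ncard_coe_finset u).symm
  choose σ hσ hunique using SimpleGraph.Subgraph.isPerfectMatching_iff.mp hM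
  exact ⟨σ, ⟨fun v => (hunique _ _ (hσ v).symm).symm, fun v => (hσ v).adj_sub.ne'⟩,
    fun v => hx.supportGraph_adj.mp (hσ v).adj_sub⟩

end EdmondsConstraints

end Cut

section Contraction

variable {V W : Type*} [Fintype V] [DecidableEq W]

theorem sum_filter_mem_eq_sum_fiber {M : Type*} [AddCommMonoid M] (π : V → W) (B : Finset W)
    (f : V → M) : ∑ v with π v ∈ B, f v = ∑ b ∈ B, ∑ v with π v = b, f v := by
  rw [← Finset.sum_fiberwise_of_maps_to (s := {v | π v ∈ B}) (t := B) (g := π) (by simp)]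
  refine Finset.sum_congr rfl fun b hb => Finset.sum_congr ?_ fun _ _ => rfl
  rw [Finset.filter_filter]
  exact Finset.filter_congr fun v _ => and_iff_right_of_imp (by rintro rfl; exact hb)

/-- The edge vector obtained by shrinking each fibre of `π` to one vertex: the values between two
fibres are added up, and those inside a fibre are dropped. -/
def contract (x : V → V → ℝ) (π : V → W) (b c : W) : ℝ :=
  if b = c then 0 else ∑ v with π v = b, ∑ w with π w = c, x v w

theorem contract_self (x : V → V → ℝ) (π : V → W) (b : W) : contract x π b b = 0 := if_pos rfl

variable [DecidableEq V] [Fintype W]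

theorem cut_contract (x : V → V → ℝ) (π : V → W) (B : Finset W) :
    cut (contract x π) B = cut x {v | π v ∈ B} := by
  have hcompl : ({v | π v ∈ B} : Finset V)ᶜ = ({v | π v ∈ Bᶜ} : Finset V) := by ext; simp
  simp only [cut, hcompl, sum_filter_mem_eq_sum_fiber π]
  refine Finset.sum_congr rfl fun b hb => ?_
  rw [Finset.sum_comm]
  refine Finset.sum_congr rfl fun c hc => if_neg ?_
  rintro rfl
  exact Finset.mem_compl.mp hc hb

theorem EdmondsConstraints.contract_of_tight {x : V → V → ℝ} (hx : EdmondsConstraints x) (π : V → W)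
    (hodd : ∀ b, Odd #{v | π v = b}) (htight : ∀ b, cut x {v | π v = b} = 1) :
    EdmondsConstraints (contract x π) where
  nonneg b c := by
    unfold contract
    split_ifs
    · exact le_rfl
    · exact Finset.sum_nonneg fun _ _ => Finset.sum_nonneg fun _ _ => hx.nonneg _ _
  symm b c := by
    simp only [contract, eq_comm (a := b)]
    rw [Finset.sum_comm]
    simp only [hx.symm]
  diag := contract_self x π
  sum_row b := by
    rw [← cut_singleton (contract_self x π), cut_contract, ← htight b]
    simp
  one_le_cut B hB := by
    rw [cut_contract]
    refine hx.one_le_cut _ ?_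
    rw [Finset.card_eq_sum_ones, sum_filter_mem_eq_sum_fiber]
    simpa [← Finset.card_eq_sum_ones, Finset.odd_sum_iff_odd_card_odd, hodd] using hB

end Contraction

section Coupling

variable {ι κ α β : Type*} [Fintype ι] [Fintype κ]

theorem exists_lift_of_sum_fiber_eq [Fintype β] [DecidableEq α] {u : ι → α} {c : ι → ℝ}
    {x : α → β → ℝ} (hc : ∀ i, 0 ≤ c i) (hx : ∀ a b, 0 ≤ x a b)
    (h : ∀ a, ∑ i with u i = a, c i = ∑ b, x a b) :
    ∃ y : ι → β → ℝ, (∀ i b, 0 ≤ y i b) ∧ (∀ i, ∑ b, y i b = c i) ∧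
      ∀ a b, ∑ i with u i = a, y i b = x a b := by
  refine ⟨fun i b => c i * x (u i) b / ∑ b, x (u i) b, fun i b => ?_, fun i => ?_, fun a b => ?_⟩
  · exact div_nonneg (mul_nonneg (hc i) (hx _ b)) (Finset.sum_nonneg fun b _ => hx _ b)
  · rw [← Finset.sum_div, ← Finset.mul_sum]
    refine mul_div_cancel_of_imp fun h0 => ?_
    exact (Finset.sum_eq_zero_iff_of_nonneg fun i _ => hc i).mp ((h (u i)).trans h0) i (by simp)
  · calc ∑ i with u i = a, c i * x (u i) b / ∑ b, x (u i) b
        = ∑ i with u i = a, c i * x a b / ∑ b, x a b :=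
          Finset.sum_congr rfl fun i hi => by rw [(Finset.mem_filter.mp hi).2]
      _ = (∑ b, x a b) * x a b / ∑ b, x a b := by rw [← Finset.sum_div, ← Finset.sum_mul, h]
      _ = x a b := mul_div_cancel_left_of_imp fun h0 =>
          (Finset.sum_eq_zero_iff_of_nonneg fun b _ => hx a b).mp h0 b (Finset.mem_univ b)

theorem exists_coupling [Fintype α] [Fintype β] [DecidableEq α] [DecidableEq β] {u : ι → α}
    {w : κ → β} {c : ι → ℝ} {d : κ → ℝ} {x : α → β → ℝ} (hc : ∀ i, 0 ≤ c i) (hd : ∀ j, 0 ≤ d j)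
    (hx : ∀ a b, 0 ≤ x a b) (hcx : ∀ a, ∑ i with u i = a, c i = ∑ b, x a b)
    (hdx : ∀ b, ∑ j with w j = b, d j = ∑ a, x a b) :
    ∃ C : ι → κ → ℝ, (∀ i j, 0 ≤ C i j) ∧ (∀ i, ∑ j, C i j = c i) ∧ (∀ j, ∑ i, C i j = d j) ∧
      ∀ a b, ∑ i with u i = a, ∑ j with w j = b, C i j = x a b := by
  obtain ⟨y, hy, hyc, hyx⟩ := exists_lift_of_sum_fiber_eq hc hx hcx
  obtain ⟨z, hz, hzd, hzy⟩ := exists_lift_of_sum_fiber_eq (u := w) (x := fun b i => y i b) hd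
    (fun b i => hy i b) fun b => by
      rw [hdx, ← Finset.sum_fiberwise _ u]
      simp only [hyx]
  refine ⟨fun i j => z j i, fun i j => hz j i, fun i => ?_, hzd, fun a b => ?_⟩
  · rw [← hyc, ← Finset.sum_fiberwise _ w]
    simp only [hzy]
  · simp only [hzy, hyx]

end Coupling

section Glue

variable {α β : Type*}

/-- Two pairings, each with an extra vertex `none` whose partner is `u` and `w` respectively,
become one pairing on the disjoint union by dropping the extra vertices and pairing `u`
with `w`. -/
def glue (σ : Option α → Option α) (τ : Option β → Option β) (u : α) (w : β) : α ⊕ β → α ⊕ β :=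
  Sum.elim (fun a => (σ (some a)).elim (.inr w) .inl) fun b => (τ (some b)).elim (.inl u) .inr

variable {σ : Option α → Option α} {τ : Option β → Option β} {u : α} {w : β}

theorem glue_inl_eq_inl {a a' : α} :
    glue σ τ u w (.inl a) = .inl a' ↔ σ (some a) = some a' := by
  cases h : σ (some a) <;> simp [glue, h]

theorem glue_inr_eq_inr {b b' : β} :
    glue σ τ u w (.inr b) = .inr b' ↔ τ (some b) = some b' := by
  cases h : τ (some b) <;> simp [glue, h]

theorem IsPairing.some_eq_none_iff (hσ : IsPairing σ) (hu : σ none = some u) {a : α} :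
    σ (some a) = none ↔ u = a := by
  rw [hσ.involutive.eq_iff, hu, Option.some_inj, eq_comm]

theorem glue_inl_eq_inr (hσ : IsPairing σ) (hu : σ none = some u) {a : α} {b : β} :
    glue σ τ u w (.inl a) = .inr b ↔ u = a ∧ w = b := by
  rw [← hσ.some_eq_none_iff hu]
  cases h : σ (some a) <;> simp [glue, h]

theorem glue_inr_eq_inl (hτ : IsPairing τ) (hw : τ none = some w) {a : α} {b : β} :
    glue σ τ u w (.inr b) = .inl a ↔ u = a ∧ w = b := by
  rw [← hτ.some_eq_none_iff hw]
  cases h : τ (some b) <;> simp [glue, h]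

theorem IsPairing.glue (hσ : IsPairing σ) (hτ : IsPairing τ) (hu : σ none = some u)
    (hw : τ none = some w) : IsPairing (glue σ τ u w) where
  involutive := by
    rintro (a | b)
    · cases h : CostOfPerfection.glue σ τ u w (.inl a) with
      | inl a' => rw [glue_inl_eq_inl] at h ⊢; rw [← h, hσ.involutive]
      | inr b' => rwa [glue_inr_eq_inl hτ hw, ← glue_inl_eq_inr hσ hu]
    · cases h : CostOfPerfection.glue σ τ u w (.inr b) with
      | inl a' => rwa [glue_inl_eq_inr hσ hu, ← glue_inr_eq_inl hτ hw]
      | inr b' => rw [glue_inr_eq_inr] at h ⊢; rw [← h, hτ.involutive]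
  ne := by
    rintro (a | b)
    · exact fun h => hσ.ne _ (glue_inl_eq_inl.mp h)
    · exact fun h => hτ.ne _ (glue_inr_eq_inr.mp h)

end Glue

section Polytope

variable {V : Type u} [DecidableEq V]

/-- The incidence vector of a pairing. -/
def pairingMatrix (σ : V → V) (a b : V) : ℝ := if σ a = b then 1 else 0

variable (V) in
/-- The perfect matching polytope of the complete graph on `V`. -/
def perfectMatchingPolytope : Set (V → V → ℝ) := convexHull ℝ (pairingMatrix '' {σ | IsPairing σ})

theorem pairingMatrix_mem {σ : V → V} (hσ : IsPairing σ) :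
    pairingMatrix σ ∈ perfectMatchingPolytope V :=
  subset_convexHull _ _ ⟨σ, hσ, rfl⟩

theorem sum_smul_pairingMatrix_mem {ι : Type*} [Fintype ι] {c : ι → ℝ} {σ : ι → V → V}
    (hc : ∀ i, 0 ≤ c i) (hsum : ∑ i, c i = 1) (hσ : ∀ i, IsPairing (σ i)) :
    ∑ i, c i • pairingMatrix (σ i) ∈ perfectMatchingPolytope V :=
  (convex_convexHull ℝ _).sum_mem (fun i _ => hc i) hsum fun i _ => pairingMatrix_mem (hσ i)

theorem sum_smul_pairingMatrix_apply {ι : Type*} [Fintype ι] (c : ι → ℝ) (σ : ι → V → V)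
    (a b : V) : (∑ i, c i • pairingMatrix (σ i)) a b = ∑ i with σ i a = b, c i := by
  simp [pairingMatrix, Finset.sum_filter]

theorem exists_sum_smul_pairingMatrix_eq {x : V → V → ℝ} (hx : x ∈ perfectMatchingPolytope V) :
    ∃ (ι : Type u) (_ : Fintype ι) (c : ι → ℝ) (σ : ι → V → V), (∀ i, 0 < c i) ∧
      ∑ i, c i = 1 ∧ (∀ i, IsPairing (σ i)) ∧ ∑ i, c i • pairingMatrix (σ i) = x := by
  obtain ⟨ι, _, z, c, hz, -, hc, hsum, rfl⟩ := eq_pos_convex_span_of_mem_convexHull hx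
  choose σ hσ hσz using fun i => hz (Set.mem_range_self i)
  exact ⟨ι, inferInstance, c, σ, hc, hsum, hσ, by simp only [hσz]⟩

/-- The average over a convex decomposition of `x` does not exceed its largest term. -/
theorem exists_isPairing_le_sum [Fintype V] {x : V → V → ℝ} (hx : x ∈ perfectMatchingPolytope V)
    (W : V → V → ℝ) :
    ∃ σ, IsPairing σ ∧ (∀ a, x a (σ a) ≠ 0) ∧ ∑ a, ∑ b, x a b * W a b ≤ ∑ a, W a (σ a) := by
  obtain ⟨ι, _, c, σ, hc, hsum, hσ, rfl⟩ := exists_sum_smul_pairingMatrix_eq hx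
  have hmean : ∑ a, ∑ b, (∑ i, c i • pairingMatrix (σ i)) a b * W a b =
      ∑ i, c i • ∑ a, W a (σ i a) := by
    simp only [sum_smul_pairingMatrix_apply, Finset.sum_filter, Finset.sum_mul, ite_mul, zero_mul,
      smul_eq_mul, Finset.mul_sum]
    simp only [Finset.sum_comm (t := (Finset.univ : Finset ι)), Finset.sum_ite_eq, Finset.mem_univ,
      if_true]
  obtain ⟨i, -, hi⟩ := Finset.exists_le_of_sum_le (s := Finset.univ)
    (Finset.univ_nonempty_iff.mpr <| by
      by_contra! h
      simp at hsum)
    (f := fun i => c i * ∑ a, ∑ b, (∑ i, c i • pairingMatrix (σ i)) a b * W a b)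
    (g := fun i => c i * ∑ a, W a (σ i a)) (by rw [← Finset.sum_mul, hsum, one_mul, hmean]; rfl)
  refine ⟨σ i, hσ i, fun a => ?_, le_of_mul_le_mul_left hi (hc i)⟩
  rw [sum_smul_pairingMatrix_apply]
  exact (Finset.sum_pos (fun j _ => hc j) ⟨i, by simp⟩).ne'

end Polytope

section Gluing

variable {α β : Type u}

theorem mem_perfectMatchingPolytope_of_equiv [DecidableEq α] [DecidableEq β] {e : α ≃ β}
    {x : β → β → ℝ} (hx : (fun a b => x (e a) (e b)) ∈ perfectMatchingPolytope α) :
    x ∈ perfectMatchingPolytope β := by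
  obtain ⟨ι, _, c, σ, hc, hsum, hσ, h⟩ := exists_sum_smul_pairingMatrix_eq hx
  have hτ (i : ι) : IsPairing fun b => e (σ i (e.symm b)) :=
    ⟨fun b => by simp [(hσ i).involutive _],
      fun b hb => (hσ i).ne (e.symm b) (e.eq_symm_apply.mpr hb)⟩
  convert sum_smul_pairingMatrix_mem (fun i => (hc i).le) hsum hτ using 1
  funext a b
  have hab := congrFun₂ h (e.symm a) (e.symm b)
  simp only [sum_smul_pairingMatrix_apply, Equiv.apply_symm_apply] at hab ⊢
  simp only [← hab, Equiv.eq_symm_apply]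

variable [Fintype α] [Fintype β] {x : α ⊕ β → α ⊕ β → ℝ}

theorem contract_inr_none_some [DecidableEq α] (a : α) :
    contract x (Sum.elim some fun _ => none) none (some a) = ∑ b, x (.inr b) (.inl a) := by
  simp [contract, Finset.sum_filter]

theorem contract_inl_none_some [DecidableEq β] (b : β) :
    contract x (Sum.elim (fun _ => none) some) none (some b) = ∑ a, x (.inl a) (.inr b) := by
  simp [contract, Finset.sum_filter]

theorem contract_inr_some_some [DecidableEq α] (hx : ∀ v, x v v = 0) (a a' : α) :
    contract x (Sum.elim some fun _ => none) (some a) (some a') = x (.inl a) (.inl a') := by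
  rcases eq_or_ne a a' with rfl | h
  · rw [contract_self, hx]
  · simp [contract, Finset.sum_filter, h]

theorem contract_inl_some_some [DecidableEq β] (hx : ∀ v, x v v = 0) (b b' : β) :
    contract x (Sum.elim (fun _ => none) some) (some b) (some b') = x (.inr b) (.inr b') := by
  rcases eq_or_ne b b' with rfl | h
  · rw [contract_self, hx]
  · simp [contract, Finset.sum_filter, h]

/-- Convex decompositions of the two contractions agree on the pairs between the two sides, so
they can be coupled such that only pairings with the same crossing pair are glued. -/
theorem mem_perfectMatchingPolytope_of_contract [DecidableEq α] [DecidableEq β]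
    (hx : ∀ v w, 0 ≤ x v w) (hsymm : ∀ v w, x v w = x w v) (hdiag : ∀ v, x v v = 0)
    (hα : contract x (Sum.elim some fun _ => none) ∈ perfectMatchingPolytope (Option α))
    (hβ : contract x (Sum.elim (fun _ => none) some) ∈ perfectMatchingPolytope (Option β)) :
    x ∈ perfectMatchingPolytope (α ⊕ β) := by
  obtain ⟨ι, _, c, σ, hc, hcsum, hσ, hcx⟩ := exists_sum_smul_pairingMatrix_eq hα
  obtain ⟨κ, _, d, τ, hd, -, hτ, hdx⟩ := exists_sum_smul_pairingMatrix_eq hβ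
  choose u hu using fun i => Option.ne_none_iff_exists'.mp ((hσ i).ne none)
  choose w hw using fun j => Option.ne_none_iff_exists'.mp ((hτ j).ne none)
  have hcσ (a b) : ∑ i with σ i a = b, c i = contract x (Sum.elim some fun _ => none) a b := by
    rw [← hcx, sum_smul_pairingMatrix_apply]
  have hdτ (a b) : ∑ j with τ j a = b, d j = contract x (Sum.elim (fun _ => none) some) a b := by
    rw [← hdx, sum_smul_pairingMatrix_apply]
  have hcu (a) : ∑ i with u i = a, c i = ∑ b, x (.inl a) (.inr b) := by
    have := hcσ none (some a)
    simpa only [hu, Option.some_inj, contract_inr_none_some, hsymm (.inr _)] using this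
  have hdw (b) : ∑ j with w j = b, d j = ∑ a, x (.inl a) (.inr b) := by
    have := hdτ none (some b)
    simpa only [hw, Option.some_inj, contract_inl_none_some] using this
  obtain ⟨C, hC, hCc, hCd, hCx⟩ := exists_coupling (fun i => (hc i).le) (fun j => (hd j).le)
    (fun a b => hx (.inl a) (.inr b)) hcu hdw
  convert sum_smul_pairingMatrix_mem (c := fun p : ι × κ => C p.1 p.2)
    (σ := fun p => glue (σ p.1) (τ p.2) (u p.1) (w p.2)) (fun p => hC _ _)
    (by simp only [Fintype.sum_prod_type, hCc, hcsum])
    (fun p => (hσ p.1).glue (hτ p.2) (hu p.1) (hw p.2)) using 1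
  funext a b
  rw [sum_smul_pairingMatrix_apply, Finset.sum_filter, Fintype.sum_prod_type]
  rcases a with a | a <;> rcases b with b | b
  · simp only [glue_inl_eq_inl, Finset.sum_ite_irrel, Finset.sum_const_zero, hCc]
    rw [← Finset.sum_filter, hcσ, contract_inr_some_some hdiag]
  · simp [glue_inl_eq_inr (hσ _) (hu _), ite_and, Finset.sum_filter, ← hCx]
  · simp [glue_inr_eq_inl (hτ _) (hw _), ite_and, Finset.sum_filter, ← hCx, hsymm (.inr a)]
  · rw [Finset.sum_comm]
    simp only [glue_inr_eq_inr, Finset.sum_ite_irrel, Finset.sum_const_zero, hCd]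
    rw [← Finset.sum_filter, hdτ, contract_inl_some_some hdiag]

end Gluing

section Edmonds

variable {V : Type u} [Fintype V] [DecidableEq V]

theorem IsPairing.edmondsConstraints_pairingMatrix {σ : V → V} (hσ : IsPairing σ) :
    EdmondsConstraints (pairingMatrix σ) where
  nonneg a b := by unfold pairingMatrix; positivity
  symm a b := by simp only [pairingMatrix, hσ.involutive.eq_iff, eq_comm (a := a)]
  diag a := if_neg (hσ.ne a)
  sum_row a := by simp [pairingMatrix]
  one_le_cut A hA := by
    obtain ⟨a, ha, hσa⟩ := hσ.exists_mem_notMem hA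
    have hnonneg (a b : V) : 0 ≤ pairingMatrix σ a b := by unfold pairingMatrix; positivity
    calc (1 : ℝ) = pairingMatrix σ a (σ a) := (if_pos rfl).symm
      _ ≤ ∑ b ∈ Aᶜ, pairingMatrix σ a b :=
        Finset.single_le_sum (fun b _ => hnonneg a b) (Finset.mem_compl.mpr hσa)
      _ ≤ cut (pairingMatrix σ) A :=
        Finset.single_le_sum (f := fun a => ∑ b ∈ Aᶜ, pairingMatrix σ a b)
          (fun a _ => Finset.sum_nonneg fun b _ => hnonneg a b) ha

theorem convex_edmondsConstraints : Convex ℝ {x : V → V → ℝ | EdmondsConstraints x} := by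
  intro x hx y hy s t hs ht hst
  refine ⟨fun a b => ?_, fun a b => ?_, fun a => ?_, fun a => ?_, fun A hA => ?_⟩
  · exact add_nonneg (mul_nonneg hs (hx.nonneg a b)) (mul_nonneg ht (hy.nonneg a b))
  · simp [hx.symm a b, hy.symm a b]
  · simp [hx.diag, hy.diag]
  · simp [Finset.sum_add_distrib, ← Finset.mul_sum, hx.sum_row, hy.sum_row, hst]
  · rw [cut_smul_add_smul, ← hst]
    nlinarith [hx.one_le_cut A hA, hy.one_le_cut A hA]

theorem isCompact_edmondsConstraints : IsCompact {x : V → V → ℝ | EdmondsConstraints x} := by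
  refine (isCompact_Icc (a := (0 : V → V → ℝ)) (b := 1)).of_isClosed_subset ?_
    fun x hx => ⟨hx.nonneg, hx.le_one⟩
  have heq : {x : V → V → ℝ | EdmondsConstraints x} = {x | (∀ a b, 0 ≤ x a b) ∧
      (∀ a b, x a b = x b a) ∧ (∀ a, x a a = 0) ∧ (∀ a, ∑ b, x a b = 1) ∧
      ∀ A : Finset V, Odd #A → 1 ≤ cut x A} :=
    Set.ext fun x => ⟨fun ⟨h₁, h₂, h₃, h₄, h₅⟩ => ⟨h₁, h₂, h₃, h₄, h₅⟩,
      fun ⟨h₁, h₂, h₃, h₄, h₅⟩ => ⟨h₁, h₂, h₃, h₄, h₅⟩⟩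
  simp only [heq, Set.ofPred_and, Set.ofPred_forall]
  refine (isClosed_iInter fun a => isClosed_iInter fun b => ?_).inter <|
    (isClosed_iInter fun a => isClosed_iInter fun b => ?_).inter <|
    (isClosed_iInter fun a => ?_).inter <| (isClosed_iInter fun a => ?_).inter <|
    isClosed_iInter fun A => isClosed_iInter fun _ => ?_
  · exact isClosed_le continuous_const (by fun_prop)
  · exact isClosed_eq (by fun_prop) (by fun_prop)
  · exact isClosed_eq (by fun_prop) continuous_const
  · exact isClosed_eq (by fun_prop) continuous_const
  · exact isClosed_le continuous_const (continuous_cut A)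

variable {x : V → V → ℝ}

theorem EdmondsConstraints.cut_eq_one_of_card_eq_one (hx : EdmondsConstraints x) {A : Finset V}
    (hA : #A = 1 ∨ #Aᶜ = 1) : cut x A = 1 := by
  rcases hA with hA | hA <;> obtain ⟨a, ha⟩ := Finset.card_eq_one.mp hA
  · rw [ha, hx.cut_singleton_eq_one]
  · rw [← cut_compl hx.symm, ha, hx.cut_singleton_eq_one]

/-- Moving `x` slightly away from a pairing in its support breaks no constraint, since the
nontrivial odd cuts of `x` leave room. -/
theorem EdmondsConstraints.eventually_perturb (hx : EdmondsConstraints x) {σ : V → V}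
    (hσ : IsPairing σ) (hxσ : ∀ v, x v (σ v) ≠ 0)
    (hstrict : ∀ A : Finset V, Odd #A → #A ≠ 1 → #Aᶜ ≠ 1 → 1 < cut x A) :
    ∀ᶠ ε : ℝ in nhdsWithin 0 (Set.Ioi 0),
      EdmondsConstraints ((1 + ε) • x + (-ε) • pairingMatrix σ) := by
  have hp := hσ.edmondsConstraints_pairingMatrix
  have hnonneg : ∀ᶠ ε : ℝ in nhdsWithin 0 (Set.Ioi 0),
      ∀ a b, 0 ≤ (1 + ε) * x a b + -ε * pairingMatrix σ a b := by
    refine Filter.eventually_all.mpr fun a => Filter.eventually_all.mpr fun b => ?_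
    rcases eq_or_ne (x a b) 0 with h | h
    · have hab : σ a ≠ b := by
        rintro rfl
        exact hxσ a h
      simp [h, pairingMatrix, hab]
    · have hpos : 0 < (1 + (0 : ℝ)) * x a b + -0 * pairingMatrix σ a b := by
        simpa using (hx.nonneg a b).lt_of_ne' h
      have hcont : Continuous fun ε : ℝ => (1 + ε) * x a b + -ε * pairingMatrix σ a b := by
        fun_prop
      exact ((hcont.tendsto 0).eventually_const_lt hpos).filter_mono nhdsWithin_le_nhds
        |>.mono fun _ => le_of_lt
  have hcut : ∀ᶠ ε : ℝ in nhdsWithin 0 (Set.Ioi 0), ∀ A : Finset V, Odd #A →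
      1 ≤ (1 + ε) * cut x A + -ε * cut (pairingMatrix σ) A := by
    refine Filter.eventually_all.mpr fun A => Filter.eventually_all.mpr fun hA => ?_
    by_cases htrivial : #A = 1 ∨ #Aᶜ = 1
    · simp [hx.cut_eq_one_of_card_eq_one htrivial, hp.cut_eq_one_of_card_eq_one htrivial]
    · have hlt : 1 < (1 + (0 : ℝ)) * cut x A + -0 * cut (pairingMatrix σ) A := by
        simpa using hstrict A hA (fun h => htrivial (.inl h)) fun h => htrivial (.inr h)
      have hcont : Continuous fun ε : ℝ =>
          (1 + ε) * cut x A + -ε * cut (pairingMatrix σ) A := by fun_prop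
      exact ((hcont.tendsto 0).eventually_const_lt hlt).filter_mono nhdsWithin_le_nhds
        |>.mono fun _ => le_of_lt
  filter_upwards [hnonneg, hcut] with ε hnonneg hcut
  refine ⟨hnonneg, fun a b => ?_, fun a => ?_, fun a => ?_, fun A hA => ?_⟩
  · simp [hx.symm a b, hp.symm a b]
  · simp [hx.diag, hp.diag]
  · simp [Finset.sum_add_distrib, ← Finset.mul_sum, hx.sum_row, hp.sum_row]
  · rw [cut_smul_add_smul]
    exact hcut A hA

theorem mem_perfectMatchingPolytope_of_mem_extremePoints
    (hx : x ∈ {x : V → V → ℝ | EdmondsConstraints x}.extremePoints ℝ)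
    (hstrict : ∀ A : Finset V, Odd #A → #A ≠ 1 → #Aᶜ ≠ 1 → 1 < cut x A) :
    x ∈ perfectMatchingPolytope V := by
  obtain ⟨hxK, hext⟩ := mem_extremePoints.mp hx
  obtain ⟨σ, hσ, hxσ⟩ := EdmondsConstraints.exists_isPairing_in_support hxK
  obtain ⟨ε, hz, hε : 0 < ε⟩ :=
    ((hxK.eventually_perturb hσ hxσ hstrict).and self_mem_nhdsWithin).exists
  have hseg : x ∈ openSegment ℝ (pairingMatrix σ) ((1 + ε) • x + (-ε) • pairingMatrix σ) := by
    refine ⟨ε / (1 + ε), 1 / (1 + ε), by positivity, by positivity,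
      by field_simp; ring, ?_⟩
    funext a b
    simp only [Pi.add_apply, Pi.smul_apply, smul_eq_mul]
    field_simp
    ring
  rw [← (hext _ hσ.edmondsConstraints_pairingMatrix _ hz hseg).1]
  exact pairingMatrix_mem hσ

theorem cut_comp_equiv {W : Type*} [Fintype W] [DecidableEq W] (e : W ≃ V) (A : Finset W) :
    cut (fun a b => x (e a) (e b)) A = cut x (A.map e.toEmbedding) := by
  have hcompl : (A.map e.toEmbedding)ᶜ = Aᶜ.map e.toEmbedding := by
    ext b
    simp
  simp [cut, hcompl]

theorem EdmondsConstraints.comp_equiv {W : Type*} [Fintype W] [DecidableEq W]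
    (hx : EdmondsConstraints x) (e : W ≃ V) : EdmondsConstraints fun a b => x (e a) (e b) where
  nonneg _ _ := hx.nonneg _ _
  symm _ _ := hx.symm _ _
  diag _ := hx.diag _
  sum_row a := by rw [Equiv.sum_comp e (x (e a)), hx.sum_row]
  one_le_cut A hA := by
    rw [cut_comp_equiv]
    exact hx.one_le_cut _ (by rwa [Finset.card_map])

section Sum

variable {α β : Type u} [Fintype α] [DecidableEq α] [Fintype β] [DecidableEq β]
  {x : α ⊕ β → α ⊕ β → ℝ}

theorem EdmondsConstraints.contract_inr (hx : EdmondsConstraints x) (hβ : Odd (Fintype.card β))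
    (htight : cut x (Finset.univ.map .inr) = 1) :
    EdmondsConstraints (contract x (Sum.elim some fun _ => none)) := by
  have hnone : ({v | Sum.elim some (fun _ => none) v = none} : Finset (α ⊕ β)) =
      Finset.univ.map .inr := by
    ext (a | b) <;> simp
  have hsome (a : α) : ({v | Sum.elim some (fun _ => none) v = some a} : Finset (α ⊕ β)) =
      {.inl a} := by
    ext (a | b) <;> simp
  refine hx.contract_of_tight _ ?_ ?_ <;> rintro (_ | a)
  · rwa [hnone, Finset.card_map]
  · rw [hsome, Finset.card_singleton]
    exact odd_one
  · rwa [hnone]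
  · rw [hsome, hx.cut_singleton_eq_one]

theorem EdmondsConstraints.contract_inl (hx : EdmondsConstraints x) (hα : Odd (Fintype.card α))
    (htight : cut x (Finset.univ.map .inl) = 1) :
    EdmondsConstraints (contract x (Sum.elim (fun _ => none) some)) := by
  have hnone : ({v | Sum.elim (fun _ => none) some v = none} : Finset (α ⊕ β)) =
      Finset.univ.map .inl := by
    ext (a | b) <;> simp
  have hsome (b : β) : ({v | Sum.elim (fun _ => none) some v = some b} : Finset (α ⊕ β)) =
      {.inr b} := by
    ext (a | b) <;> simp
  refine hx.contract_of_tight _ ?_ ?_ <;> rintro (_ | b)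
  · rwa [hnone, Finset.card_map]
  · rw [hsome, Finset.card_singleton]
    exact odd_one
  · rwa [hnone]
  · rw [hsome, hx.cut_singleton_eq_one]

theorem EdmondsConstraints.mem_of_tight_cut (hx : EdmondsConstraints x)
    (hα : Odd (Fintype.card α)) (htight : cut x (Finset.univ.map .inl) = 1)
    (ihα : ∀ y : Option α → Option α → ℝ, EdmondsConstraints y →
      y ∈ perfectMatchingPolytope (Option α))
    (ihβ : ∀ y : Option β → Option β → ℝ, EdmondsConstraints y →
      y ∈ perfectMatchingPolytope (Option β)) :
    x ∈ perfectMatchingPolytope (α ⊕ β) := by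
  have hβ : Odd (Fintype.card β) := by
    have heven := hx.even_card
    rw [Fintype.card_sum] at heven
    exact (Nat.even_add'.mp heven).mp hα
  have hinr : (Finset.univ.map Function.Embedding.inr : Finset (α ⊕ β)) =
      (Finset.univ.map Function.Embedding.inl)ᶜ := by
    ext (a | b) <;> simp
  exact mem_perfectMatchingPolytope_of_contract hx.nonneg hx.symm hx.diag
    (ihα _ (hx.contract_inr hβ (by rw [hinr, cut_compl hx.symm, htight])))
    (ihβ _ (hx.contract_inl hα htight))

end Sum

/-- **Edmonds' perfect matching polytope theorem.** -/
theorem EdmondsConstraints.mem_perfectMatchingPolytope (hx : EdmondsConstraints x) :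
    x ∈ perfectMatchingPolytope V := by
  induction hn : Fintype.card V using Nat.strong_induction_on generalizing V with
  | _ n ih =>
  have hclosed : IsClosed (perfectMatchingPolytope V) :=
    (Set.toFinite (pairingMatrix '' {σ : V → V | IsPairing σ})).isClosed_convexHull ℝ
  suffices h : {x : V → V → ℝ | EdmondsConstraints x}.extremePoints ℝ ⊆
      perfectMatchingPolytope V by
    have hmem : x ∈ closure (convexHull ℝ ({x | EdmondsConstraints x}.extremePoints ℝ)) := by
      rwa [closure_convexHull_extremePoints isCompact_edmondsConstraints
        convex_edmondsConstraints]
    exact closure_minimal (convexHull_min h (convex_convexHull ℝ _)) hclosed hmem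
  intro y hy
  have hyK : EdmondsConstraints y := hy.1
  by_contra hmem
  obtain ⟨A, hA, hA₁, hAc₁, hcut⟩ : ∃ A : Finset V, Odd #A ∧ #A ≠ 1 ∧ #Aᶜ ≠ 1 ∧ cut y A = 1 := by
    by_contra! h
    exact hmem (mem_perfectMatchingPolytope_of_mem_extremePoints hy fun A hA hA₁ hAc₁ =>
      (hyK.one_le_cut A hA).lt_of_ne (h A hA hA₁ hAc₁).symm)
  have hcard := Finset.card_add_card_compl A
  have hAc : Odd #Aᶜ := (Nat.even_add'.mp (hcard ▸ hyK.even_card)).mp hA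
  have hcompl : Fintype.card {v // v ∉ A} = #Aᶜ := by
    rw [Fintype.card_subtype_compl, Fintype.card_coe, Finset.card_compl]
  refine hmem (mem_perfectMatchingPolytope_of_equiv (e := Equiv.sumCompl (· ∈ A))
    ((hyK.comp_equiv _).mem_of_tight_cut (by rwa [Fintype.card_coe]) ?_ (fun z hz => ih _ ?_ hz rfl)
      (fun z hz => ih _ ?_ hz rfl)))
  · rw [cut_comp_equiv, ← hcut]
    congr 1
    ext v
    by_cases hv : v ∈ A <;> simp [hv]
  · rw [Fintype.card_option, Fintype.card_coe]
    have := hAc.pos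
    omega
  · rw [Fintype.card_option, hcompl]
    have := hA.pos
    omega

end Edmonds

section Weights

variable {V : Type} {G : SimpleGraph V}

/-- The extension by zero of an edge weight to all pairs of vertices. -/
def pairWeight (w : G.edgeSet → ℝ≥0) (e : Sym2 V) : ℝ :=
  Function.extend Subtype.val (fun e => (w e : ℝ)) 0 e

theorem pairWeight_coe (w : G.edgeSet → ℝ≥0) (e : G.edgeSet) : pairWeight w e = w e :=
  Subtype.val_injective.extend_apply _ _ e

theorem pairWeight_of_notMem (w : G.edgeSet → ℝ≥0) {e : Sym2 V} (he : e ∉ G.edgeSet) :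
    pairWeight w e = 0 :=
  Function.extend_apply' _ _ _ (by simpa using he)

theorem pairWeight_nonneg (w : G.edgeSet → ℝ≥0) (e : Sym2 V) : 0 ≤ pairWeight w e := by
  by_cases he : e ∈ G.edgeSet
  · exact (pairWeight_coe w ⟨e, he⟩).symm ▸ NNReal.coe_nonneg _
  · exact (pairWeight_of_notMem w he).ge

theorem weight_eq_finsum_pairWeight (w : G.edgeSet → ℝ≥0) (M : G.Subgraph) :
    weight G w M = ∑ᶠ e ∈ M.edgeSet, pairWeight w e := by
  have himage : Subtype.val '' {e : G.edgeSet | (e : Sym2 V) ∈ M.edgeSet} = M.edgeSet :=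
    Subtype.image_preimage_coe _ _ |>.trans (Set.inter_eq_right.mpr M.edgeSet_subset)
  rw [← himage, finsum_mem_image Subtype.val_injective.injOn]
  exact finsum_mem_congr rfl fun e _ => (pairWeight_coe w e).symm

/-- Every edge is counted twice, once for each of its directions. -/
theorem sum_sum_adj_eq_two_mul_finsum [Fintype V] (H : SimpleGraph V) [DecidableRel H.Adj]
    (f : Sym2 V → ℝ) :
    ∑ a, ∑ b, (if H.Adj a b then f s(a, b) else 0) = 2 * ∑ᶠ e ∈ H.edgeSet, f e := by
  classical
  have hdarts : ∑ p : V × V, (if H.Adj p.1 p.2 then f s(p.1, p.2) else 0) =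
      ∑ d : H.Dart, f d.edge := by
    rw [← Finset.sum_filter]
    exact (Finset.sum_bij (fun d _ => d.toProd) (fun d _ => by simp [d.adj])
      (fun d _ d' _ h => SimpleGraph.Dart.ext _ _ h)
      (fun p hp => ⟨⟨p, (Finset.mem_filter.mp hp).2⟩, Finset.mem_univ _, rfl⟩)
      (fun d _ => rfl)).symm
  rw [← Fintype.sum_prod_type' (f := fun a b => if H.Adj a b then f s(a, b) else 0), hdarts,
    ← SimpleGraph.coe_edgeFinset, finsum_mem_coe_finset, Finset.mul_sum,
    ← Finset.sum_fiberwise_of_maps_to (t := H.edgeFinset) (g := SimpleGraph.Dart.edge)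
      (by simp [SimpleGraph.Dart.edge_mem])]
  refine Finset.sum_congr rfl fun e he => ?_
  rw [Finset.sum_congr rfl fun d hd => congrArg f (Finset.mem_filter.mp hd).2, Finset.sum_const,
    H.dart_edge_fiber_card e (SimpleGraph.mem_edgeFinset.mp he), nsmul_eq_mul, Nat.cast_ofNat]

theorem two_mul_weight [Fintype V] (w : G.edgeSet → ℝ≥0) (M : G.Subgraph)
    [DecidableRel M.Adj] :
    2 * weight G w M = ∑ a, ∑ b, if M.Adj a b then pairWeight w s(a, b) else 0 := by
  classical
  rw [weight_eq_finsum_pairWeight, ← M.edgeSet_spanningCoe, ← sum_sum_adj_eq_two_mul_finsum]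
  simp only [SimpleGraph.Subgraph.spanningCoe_adj]

theorem two_mul_weight_le [Fintype V] (w : G.edgeSet → ℝ≥0) (M : G.Subgraph) :
    2 * weight G w M ≤ ∑ a, ∑ b, pairWeight w s(a, b) := by
  classical
  rw [two_mul_weight]
  gcongr with a _ b _
  split_ifs
  exacts [le_rfl, pairWeight_nonneg w _]

theorem IsConnectedCubic.edgeSet_nonempty (hG : IsConnectedCubic G) : G.edgeSet.Nonempty := by
  obtain ⟨v⟩ := hG.1.nonempty
  obtain ⟨u, hu⟩ := Set.nonempty_of_ncard_ne_zero ((hG.2 v).trans_ne three_ne_zero)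
  exact ⟨s(v, u), hu⟩

end Weights

section PerfectMatchings

variable {V : Type} {G : SimpleGraph V}

/-- The subgraph formed by the edges between `v` and `σ v`. -/
def IsPairing.toSubgraph {σ : V → V} (hσ : IsPairing σ) (hG : ∀ v, G.Adj v (σ v)) :
    G.Subgraph where
  verts := Set.univ
  Adj a b := σ a = b
  adj_sub := by
    rintro a b rfl
    exact hG a
  edge_vert _ := Set.mem_univ _
  symm := ⟨fun _ _ h => hσ.involutive.eq_iff.mp h |>.symm⟩

theorem IsPairing.isPerfectMatching_toSubgraph {σ : V → V} (hσ : IsPairing σ)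
    (hG : ∀ v, G.Adj v (σ v)) : (hσ.toSubgraph hG).IsPerfectMatching := by
  rw [SimpleGraph.Subgraph.isPerfectMatching_iff]
  exact fun v => ⟨σ v, rfl, fun b hb => Eq.symm hb⟩

theorem exists_isPairing_of_isPerfectMatching {P : G.Subgraph} (hP : P.IsPerfectMatching) :
    ∃ σ, IsPairing σ ∧ ∀ a b, P.Adj a b ↔ σ a = b := by
  rw [SimpleGraph.Subgraph.isPerfectMatching_iff] at hP
  choose σ hσ hunique using hP
  refine ⟨σ, ⟨fun v => (hunique _ _ (hσ v).symm).symm, fun v => (hσ v).adj_sub.ne'⟩,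
    fun a b => ⟨fun h => (hunique a b h).symm, ?_⟩⟩
  rintro rfl
  exact hσ a

theorem two_mul_weight_of_adj_iff [Fintype V] (w : G.edgeSet → ℝ≥0) {P : G.Subgraph} {σ : V → V}
    (h : ∀ a b, P.Adj a b ↔ σ a = b) : 2 * weight G w P = ∑ a, pairWeight w s(a, σ a) := by
  classical
  rw [two_mul_weight]
  simp_rw [h, Finset.sum_ite_eq, Finset.mem_univ, if_true]

end PerfectMatchings

section LowerBound

variable {V : Type} [Finite V] [DecidableEq V] {G : SimpleGraph V}

theorem le_eta_of_mem_perfectMatchingPolytope (hG : G.edgeSet.Nonempty) {x : V → V → ℝ}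
    (hx : x ∈ perfectMatchingPolytope V) (hsupport : ∀ a b, x a b ≠ 0 → G.Adj a b) {q : ℝ}
    (hq : 0 ≤ q) (hle : ∀ a b, G.Adj a b → q ≤ x a b) : q ≤ eta G := by
  have := Fintype.ofFinite V
  obtain ⟨w, hw, hr⟩ := (eta_isLeast G hG).1
  rw [hr, le_div_iff₀ (maxMatchingWeight_pos G w hw)]
  obtain ⟨M, -, hM⟩ := (maxMatchingWeight_isGreatest G w).1
  obtain ⟨σ, hσ, hσx, hσw⟩ := exists_isPairing_le_sum hx fun a b => pairWeight w s(a, b)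
  have hadj : ∀ a, G.Adj a (σ a) := fun a => hsupport _ _ (hσx a)
  have hperfect := hσ.isPerfectMatching_toSubgraph hadj
  have hmax := (maxPerfectMatchingWeight_isGreatest G w ⟨_, hperfect⟩).2 ⟨_, hperfect, rfl⟩
  have hedges : q * ∑ a, ∑ b, pairWeight w s(a, b) ≤ ∑ a, ∑ b, x a b * pairWeight w s(a, b) := by
    simp_rw [Finset.mul_sum]
    refine Finset.sum_le_sum fun a _ => Finset.sum_le_sum fun b _ => ?_
    by_cases hab : G.Adj a b
    · exact mul_le_mul_of_nonneg_right (hle a b hab) (pairWeight_nonneg w _)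
    · simp [pairWeight_of_notMem w (e := s(a, b)) hab]
  have htotal := mul_le_mul_of_nonneg_left (two_mul_weight_le w M) hq
  have hσ_weight := two_mul_weight_of_adj_iff w (P := hσ.toSubgraph hadj) fun _ _ => Iff.rfl
  rw [hM] at htotal
  linarith

end LowerBound

section UpperBound

variable {V : Type} {G : SimpleGraph V} {M : Set (Sym2 V)}

/-- A matching of `G`, given as a set of edges. -/
structure IsEdgeMatching (G : SimpleGraph V) (M : Set (Sym2 V)) : Prop where
  subset : M ⊆ G.edgeSet
  eq_of_mem : ∀ e ∈ M, ∀ f ∈ M, ∀ v ∈ e, v ∈ f → e = f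

theorem saturates_of_mem {a b : V} (h : s(a, b) ∈ M) : Saturates M a :=
  ⟨_, h, Sym2.mem_mk_left a b⟩

theorem saturates_iff_exists {a : V} : Saturates M a ↔ ∃ b, s(a, b) ∈ M := by
  constructor
  · rintro ⟨e, he, b, rfl⟩
    exact ⟨b, he⟩
  · rintro ⟨b, h⟩
    exact saturates_of_mem h

namespace IsEdgeMatching

/-- The subgraph formed by the edges of a matching. -/
def toSubgraph (hM : IsEdgeMatching G M) : G.Subgraph where
  verts := {v | Saturates M v}
  Adj a b := s(a, b) ∈ M
  adj_sub h := hM.subset h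
  edge_vert h := saturates_of_mem h
  symm := ⟨fun _ _ h => Sym2.eq_swap ▸ h⟩

theorem toSubgraph_adj (hM : IsEdgeMatching G M) {a b : V} :
    hM.toSubgraph.Adj a b ↔ s(a, b) ∈ M := Iff.rfl

theorem isMatching_toSubgraph (hM : IsEdgeMatching G M) : hM.toSubgraph.IsMatching := by
  intro a ha
  obtain ⟨b, hb⟩ := saturates_iff_exists.mp ha
  exact ⟨b, hb, fun c hc => Sym2.congr_right.mp
    (hM.eq_of_mem _ hc _ hb a (Sym2.mem_mk_left _ _) (Sym2.mem_mk_left _ _))⟩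

open Classical in
theorem sum_indicator [Fintype V] (hM : IsEdgeMatching G M) (a : V) :
    ∑ b, (if s(a, b) ∈ M then (1 : ℝ) else 0) = if Saturates M a then 1 else 0 := by
  split_ifs with ha
  · obtain ⟨b, hb, hunique⟩ := hM.isMatching_toSubgraph ha
    have hiff : ∀ c, s(a, c) ∈ M ↔ b = c := fun c =>
      ⟨fun hc => (hunique c hc).symm, fun h => h ▸ hb⟩
    simp_rw [hiff, Finset.sum_ite_eq, Finset.mem_univ, if_true]
  · exact Finset.sum_eq_zero fun b _ => if_neg fun h => ha (saturates_of_mem h)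

/-- The weights are the indicator function of `M`. -/
theorem eta_le_of_forall_isPairing [Finite V] (hM : IsEdgeMatching G M) (hne : M.Nonempty) {q : ℝ}
    (hq : 0 ≤ q) (h : ∀ σ, IsPairing σ → (∀ v, G.Adj v (σ v)) →
      ({v | s(v, σ v) ∈ M}.ncard : ℝ) ≤ q * {v | Saturates M v}.ncard) : eta G ≤ q := by
  classical
  have := Fintype.ofFinite V
  let w : G.edgeSet → ℝ≥0 := fun e => if (e : Sym2 V) ∈ M then 1 else 0
  obtain ⟨e₀, he₀⟩ := hne
  have hw : w ≠ 0 := Function.ne_iff.mpr ⟨⟨e₀, hM.subset he₀⟩, by simp [w, he₀]⟩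
  have hpairWeight : ∀ e, pairWeight w e = if e ∈ M then 1 else 0 := by
    intro e
    by_cases he : e ∈ G.edgeSet
    · rw [pairWeight_coe w ⟨e, he⟩]
      split_ifs <;> simp_all [w]
    · rw [pairWeight_of_notMem w he, if_neg fun h => he (hM.subset h)]
  have hM_weight : 2 * weight G w hM.toSubgraph = {v | Saturates M v}.ncard := by
    rw [two_mul_weight]
    simp_rw [toSubgraph_adj, hpairWeight, ← ite_and, and_self, hM.sum_indicator, Finset.sum_boole,
      Set.ncard_eq_toFinset_card', Set.toFinset_ofPred]
  have hmax : weight G w hM.toSubgraph ≤ maxMatchingWeight G w :=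
    (maxMatchingWeight_isGreatest G w).2 ⟨_, hM.isMatching_toSubgraph, rfl⟩
  have hperfect : maxPerfectMatchingWeight G w ≤ q * maxMatchingWeight G w := by
    refine Real.sSup_le ?_ (mul_nonneg hq (maxMatchingWeight_pos G w hw).le)
    rintro _ ⟨P, hP, rfl⟩
    obtain ⟨σ, hσ, hPσ⟩ := exists_isPairing_of_isPerfectMatching hP
    have hP_weight : 2 * weight G w P = {v | s(v, σ v) ∈ M}.ncard := by
      rw [two_mul_weight_of_adj_iff w hPσ, Set.ncard_eq_toFinset_card']
      simp [hpairWeight]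
    have hbound := h σ hσ fun v => ((hPσ v _).mpr rfl).adj_sub
    nlinarith
  refine ((eta_isLeast G ⟨e₀, hM.subset he₀⟩).2 ⟨w, hw, rfl⟩).trans ?_
  rwa [div_le_iff₀ (maxMatchingWeight_pos G w hw)]

end IsEdgeMatching

/-- A matching `M` that covers three fifths of the vertices and leaves an independent set
uncovered, as the distinguished matchings of the snarks in `petersenSnarkFamily` do. -/
structure IsSparseMaximalMatching (G : SimpleGraph V) (M : Set (Sym2 V)) : Prop
    extends IsEdgeMatching G M where
  saturates_or : ∀ a b, G.Adj a b → Saturates M a ∨ Saturates M b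
  card : 5 * {v | Saturates M v}.ncard = 3 * Nat.card V

/-- The two fifths of the vertices that `M` leaves uncovered are independent, so a perfect matching
pairs them with two thirds of the vertices covered by `M`. -/
theorem IsSparseMaximalMatching.three_mul_ncard_le [Finite V] (hM : IsSparseMaximalMatching G M)
    {σ : V → V} (hσ : IsPairing σ) (hadj : ∀ v, G.Adj v (σ v)) :
    3 * {v | s(v, σ v) ∈ M}.ncard ≤ {v | Saturates M v}.ncard := by
  set S := {v | Saturates M v}
  have hpartners : {v | s(v, σ v) ∈ M} ∪ σ '' Sᶜ ⊆ S := by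
    rintro v (hv | ⟨u, hu, rfl⟩)
    · exact saturates_of_mem hv
    · exact (hM.saturates_or u (σ u) (hadj u)).resolve_left hu
  have hdisjoint : Disjoint {v | s(v, σ v) ∈ M} (σ '' Sᶜ) := by
    rw [Set.disjoint_right]
    rintro _ ⟨u, hu, rfl⟩ hmem
    rw [Set.mem_ofPred_eq, hσ.involutive u, Sym2.eq_swap] at hmem
    exact hu (saturates_of_mem hmem)
  have hle := Set.ncard_le_ncard hpartners
  rw [Set.ncard_union_eq hdisjoint, Set.ncard_image_of_injective _ hσ.involutive.injective] at hle
  have hcompl := Set.ncard_add_ncard_compl S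
  have hcard : 5 * S.ncard = 3 * Nat.card V := hM.card
  omega

theorem IsSparseMaximalMatching.eta_le [Finite V] [Nonempty V]
    (hM : IsSparseMaximalMatching G M) : eta G ≤ 1 / 3 := by
  have hsaturated : 0 < {v | Saturates M v}.ncard := by
    have := hM.card
    have := Nat.card_pos (α := V)
    omega
  obtain ⟨v, e, he, -⟩ := Set.nonempty_of_ncard_ne_zero hsaturated.ne'
  refine hM.eta_le_of_forall_isPairing ⟨e, he⟩ (by norm_num) fun σ hσ hadj => ?_
  have : (3 * {v | s(v, σ v) ∈ M}.ncard : ℝ) ≤ {v | Saturates M v}.ncard :=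
    mod_cast hM.three_mul_ncard_le hσ hadj
  linarith

end UpperBound

section CoveringPairings

variable {V : Type} [Finite V] {G : SimpleGraph V}

theorem inv_card_le_eta_of_forall_exists_pairing {ι : Type*} [Fintype ι]
    (hG : G.edgeSet.Nonempty) {σ : ι → V → V} (hσ : ∀ i, IsPairing (σ i))
    (hadj : ∀ i v, G.Adj v (σ i v)) (hcover : ∀ a b, G.Adj a b → ∃ i, σ i a = b) :
    (Fintype.card ι : ℝ)⁻¹ ≤ eta G := by
  classical
  have := Fintype.ofFinite V
  have : Nonempty ι := by
    obtain ⟨e, he⟩ := hG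
    induction e with | h a b => exact (hcover a b he).nonempty
  have hmem := sum_smul_pairingMatrix_mem (c := fun _ => (Fintype.card ι : ℝ)⁻¹)
    (fun _ => by positivity) (by simp) hσ
  refine le_eta_of_mem_perfectMatchingPolytope hG hmem (fun a b hab => ?_) (by positivity)
    fun a b hab => ?_
  · rw [sum_smul_pairingMatrix_apply] at hab
    obtain ⟨i, hi, -⟩ := Finset.exists_ne_zero_of_sum_ne_zero hab
    exact (Finset.mem_filter.mp hi).2 ▸ hadj i a
  · obtain ⟨i, hi⟩ := hcover a b hab
    rw [sum_smul_pairingMatrix_apply]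
    exact Finset.single_le_sum (f := fun _ => (Fintype.card ι : ℝ)⁻¹) (fun _ _ => by positivity)
      (Finset.mem_filter.mpr ⟨Finset.mem_univ i, hi⟩)

theorem IsTaitColorable.third_le_eta (hG : IsTaitColorable G) : 1 / 3 ≤ eta G := by
  obtain ⟨hcubic, P, hP, hcover⟩ := hG
  choose σ hσ hPσ using fun i => exists_isPairing_of_isPerfectMatching (hP i)
  have hbound := inv_card_le_eta_of_forall_exists_pairing hcubic.edgeSet_nonempty hσ
    (fun i v => ((hPσ i v _).mpr rfl).adj_sub)
    (fun a b hab => (hcover s(a, b) hab).exists.imp fun i hi => (hPσ i a b).mp hi)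
  simpa using hbound

end CoveringPairings

section Interedges

variable {V : Type*} {G : SimpleGraph V} [DecidableRel G.Adj]

theorem even_card_interedges_self (A : Finset V) : Even #(G.interedges A A) := by
  rw [← ZMod.natCast_eq_zero_iff_even, Finset.cast_card]
  refine Finset.sum_involution (fun p _ => p.swap) (fun _ _ => by decide) (fun p hp _ h => ?_)
    (fun p hp => ?_) (fun p _ => p.swap_swap)
  · exact (G.mem_interedges_iff.mp hp).2.2.ne (congrArg Prod.snd h)
  · simp only [SimpleGraph.mem_interedges_iff, Prod.fst_swap, Prod.snd_swap] at hp ⊢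
    exact ⟨hp.2.1, hp.1, hp.2.2.symm⟩

theorem card_interedges_self_add_compl [Fintype V] [DecidableEq V] {r : ℕ}
    (hG : ∀ v, (G.neighborSet v).ncard = r) (A : Finset V) :
    #(G.interedges A A) + #(G.interedges A Aᶜ) = r * #A := by
  have hdegree : ∀ a, ∑ b, (if G.Adj a b then 1 else 0) = r := fun a => by
    rw [← hG a, Set.ncard_eq_toFinset_card', ← Finset.card_filter]
    congr 1
    ext b
    simp
  simp_rw [SimpleGraph.interedges, Rel.interedges, Finset.card_filter, Finset.sum_product,
    ← Finset.sum_add_distrib, Finset.sum_add_sum_compl, hdegree, Finset.sum_const, smul_eq_mul,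
    mul_comm r]

end Interedges

section UniformVector

variable {V : Type} {G : SimpleGraph V}

open Classical in
/-- The vector that gives each edge of an `r`-regular graph the value `1 / r`. -/
def uniformVector (G : SimpleGraph V) (r : ℕ) (a b : V) : ℝ := if G.Adj a b then (r : ℝ)⁻¹ else 0

open Classical in
theorem cut_uniformVector [Fintype V] (r : ℕ) (A : Finset V) :
    cut (uniformVector G r) A = #(G.interedges A Aᶜ) / r := by
  rw [SimpleGraph.interedges, Rel.interedges, Finset.card_filter, Finset.sum_product]
  simp [cut, uniformVector, div_eq_mul_inv, Finset.sum_mul, ← Finset.sum_filter]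

open Classical in
theorem edmondsConstraints_uniformVector [Fintype V] {r : ℕ} (hr : r ≠ 0)
    (hG : ∀ v, (G.neighborSet v).ncard = r)
    (hcut : ∀ A : Finset V, Odd #A → r ≤ #(G.interedges A Aᶜ)) :
    EdmondsConstraints (uniformVector G r) where
  nonneg a b := by unfold uniformVector; positivity
  symm a b := by simp only [uniformVector, G.adj_comm]
  diag a := by simp [uniformVector]
  sum_row a := by
    have hneighbors : #{b | G.Adj a b} = r := by
      rw [← hG a, Set.ncard_eq_toFinset_card']
      congr 1
      ext b
      simp
    simp [uniformVector, ← Finset.sum_filter, hneighbors, hr]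
  one_le_cut A hA := by
    rw [cut_uniformVector, one_le_div (by positivity)]
    exact_mod_cast hcut A hA

theorem IsBridgeless.reachable_deleteEdges (hG : IsBridgeless G) {a b : V} (hab : G.Adj a b) :
    (G.deleteEdges {s(a, b)}).Reachable a b := by
  have h := hG s(a, b) hab
  rwa [SimpleGraph.isBridge_iff, not_not] at h

theorem IsBridgeless.card_interedges_compl_ne_one [Fintype V] [DecidableEq V] [DecidableRel G.Adj]
    (hG : IsBridgeless G) (A : Finset V) : #(G.interedges A Aᶜ) ≠ 1 := by
  intro h
  obtain ⟨⟨a, b⟩, hp⟩ := Finset.card_eq_one.mp h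
  have hmem : ∀ c d, c ∈ A → d ∉ A → G.Adj c d → (c, d) = (a, b) := fun c d hc hd hcd => by
    rw [← Finset.mem_singleton, ← hp]
    simp [SimpleGraph.mem_interedges_iff, hc, hd, hcd]
  obtain ⟨ha, hb, hab⟩ : a ∈ A ∧ b ∉ A ∧ G.Adj a b := by
    have : (a, b) ∈ G.interedges A Aᶜ := hp ▸ Finset.mem_singleton_self _
    simpa [SimpleGraph.mem_interedges_iff] using this
  obtain ⟨walk⟩ := hG.reachable_deleteEdges hab
  obtain ⟨d, -, hfst, hsnd⟩ := walk.exists_boundary_dart A ha hb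
  obtain ⟨hadj, hne⟩ := SimpleGraph.deleteEdges_adj.mp d.adj
  obtain ⟨hda, hdb⟩ := Prod.mk.inj (hmem _ _ hfst hsnd hadj)
  exact hne (by rw [hda, hdb]; rfl)

theorem IsBridgeless.three_le_card_interedges_compl [Fintype V] [DecidableEq V]
    [DecidableRel G.Adj] (hG : IsBridgeless G) (hcubic : ∀ v, (G.neighborSet v).ncard = 3)
    {A : Finset V} (hA : Odd #A) : 3 ≤ #(G.interedges A Aᶜ) := by
  have hinner := even_card_interedges_self (G := G) A
  have hsum := card_interedges_self_add_compl hcubic A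
  have hne := hG.card_interedges_compl_ne_one A
  grind

theorem IsBridgeless.third_le_eta [Finite V] (hb : IsBridgeless G) (hG : IsConnectedCubic G) :
    1 / 3 ≤ eta G := by
  classical
  have := Fintype.ofFinite V
  have hconstraints := edmondsConstraints_uniformVector three_ne_zero hG.2
    fun _ => hb.three_le_card_interedges_compl hG.2
  refine le_eta_of_mem_perfectMatchingPolytope hG.edgeSet_nonempty
    hconstraints.mem_perfectMatchingPolytope (fun a b h => ?_) (by norm_num) fun a b h => ?_
  · by_contra hab
    exact h (if_neg hab)
  · simp [uniformVector, h]

theorem isBridgeless_of_isHamiltonian [Fintype V] [DecidableEq V] (hG : G.IsHamiltonian) :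
    IsBridgeless G :=
  fun _ _ he => he.not_isHamiltonian hG

end UniformVector

section DisjointEdges

variable {V : Type} [Finite V] {G : SimpleGraph V}

theorem eta_le_half_of_disjoint_edges {a b c d : V} (hab : G.Adj a b) (hcd : G.Adj c d)
    (hac : a ≠ c) (had : a ≠ d) (hbc : b ≠ c) (hbd : b ≠ d)
    (h : ∀ σ, IsPairing σ → (∀ v, G.Adj v (σ v)) → σ a = b → σ c ≠ d) : eta G ≤ 1 / 2 := by
  have hM : IsEdgeMatching G {s(a, b), s(c, d)} := by
    constructor
    · rintro e (rfl | rfl)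
      exacts [hab, hcd]
    · rintro e (rfl | rfl) f (rfl | rfl) v hv hv' <;> simp only [Sym2.mem_iff] at hv hv' <;> grind
  have hsaturated : {v | Saturates {s(a, b), s(c, d)} v} = {a, b, c, d} := by
    ext v
    simp [Saturates, or_assoc]
  refine hM.eta_le_of_forall_isPairing ⟨_, .inl rfl⟩ (by norm_num) fun σ hσ hadj => ?_
  have hends : ∀ {v p q}, s(v, σ v) = s(p, q) → σ p = q ∧ v ∈ ({p, q} : Set V) := by
    intro v p q hv
    rcases Sym2.eq_iff.mp hv with ⟨rfl, rfl⟩ | ⟨rfl, rfl⟩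
    exacts [⟨rfl, .inl rfl⟩, ⟨hσ.involutive v, .inr rfl⟩]
  obtain ⟨p, q, hpq⟩ : ∃ p q, {v | s(v, σ v) ∈ ({s(a, b), s(c, d)} : Set (Sym2 V))} ⊆ {p, q} := by
    by_cases hσab : σ a = b
    · exact ⟨a, b, fun v hv => hv.elim (fun hv => (hends hv).2)
        fun hv => absurd (hends hv).1 (h σ hσ hadj hσab)⟩
    · exact ⟨c, d, fun v hv => hv.elim (fun hv => absurd (hends hv).1 hσab)
        fun hv => (hends hv).2⟩
  have hcommon := (Set.ncard_le_ncard hpq).trans (Set.ncard_insert_le p {q})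
  rw [Set.ncard_singleton] at hcommon
  have hfour : ({a, b, c, d} : Set V).ncard = 4 := by
    rw [Set.ncard_insert_of_notMem (by simp [hab.ne, hac, had]),
      Set.ncard_insert_of_notMem (by simp [hbc, hbd]), Set.ncard_pair hcd.ne]
  rw [hsaturated, hfour]
  have : ({v | s(v, σ v) ∈ ({s(a, b), s(c, d)} : Set (Sym2 V))}.ncard : ℝ) ≤ 2 := mod_cast hcommon
  push_cast
  linarith

end DisjointEdges

section Reachability

variable {V W : Type*} {G : SimpleGraph V} {H : SimpleGraph W}

theorem reachable_of_forall_adj {f : V → W} (hf : ∀ c d, G.Adj c d → H.Reachable (f c) (f d))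
    {a b : V} (hab : G.Reachable a b) : H.Reachable (f a) (f b) := by
  obtain ⟨walk⟩ := hab
  induction walk with
  | nil => rfl
  | cons h _ ih => exact (hf _ _ h).trans ih

end Reachability

section Transport

variable {V W : Type} {G : SimpleGraph V} {H : SimpleGraph W}

theorem isBridgeless_of_forall_reachable_deleteEdges {r : V → V → Prop}
    (hr : ∀ a b, G.Adj a b → r a b ∨ r b a)
    (h : ∀ a b, r a b → (G.deleteEdges {s(a, b)}).Reachable a b) : IsBridgeless G := by
  intro e he hbridge
  induction e with | h a b =>
  rcases hr a b he with hab | hba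
  · exact SimpleGraph.isBridge_iff.mp hbridge (h a b hab)
  · exact SimpleGraph.isBridge_iff.mp (Sym2.eq_swap ▸ hbridge) (h b a hba)

theorem IsConnectedCubic.of_iso (hH : IsConnectedCubic H) (e : G ≃g H) : IsConnectedCubic G :=
  ⟨e.connected_iff.mpr hH.1, fun v =>
    (Nat.card_congr (e.mapNeighborSet v)).trans (hH.2 (e v))⟩

theorem reachable_deleteEdges_of_iso (e : G ≃g H) {a b : V}
    (h : (H.deleteEdges {s(e a, e b)}).Reachable (e a) (e b)) :
    (G.deleteEdges {s(a, b)}).Reachable a b := by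
  rw [← e.symm_apply_apply a, ← e.symm_apply_apply b]
  refine reachable_of_forall_adj (fun c d hcd => SimpleGraph.Adj.reachable ?_) h
  rw [SimpleGraph.deleteEdges_adj] at hcd ⊢
  refine ⟨e.symm.map_adj_iff.mpr hcd.1, fun hmem => hcd.2 ?_⟩
  have := congrArg (Sym2.map e) (Set.mem_singleton_iff.mp hmem)
  simpa using this

theorem IsBridgeless.of_iso (hH : IsBridgeless H) (e : G ≃g H) : IsBridgeless G :=
  isBridgeless_of_forall_reachable_deleteEdges (fun _ _ => .inl) fun _ _ hab =>
    reachable_deleteEdges_of_iso e (hH.reachable_deleteEdges (e.map_adj_iff.mpr hab))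

theorem saturates_preimage_iff {M : Set (Sym2 W)} (e : V ≃ W) {a : V} :
    Saturates (Sym2.map e ⁻¹' M) a ↔ Saturates M (e a) := by
  simp_rw [saturates_iff_exists, Set.mem_preimage, Sym2.map_mk, e.exists_congr_left]
  simp

theorem IsSparseMaximalMatching.of_iso {M : Set (Sym2 W)} (hM : IsSparseMaximalMatching H M)
    (e : G ≃g H) : IsSparseMaximalMatching G (Sym2.map e ⁻¹' M) where
  subset f hf := by
    induction f with | h a b => exact e.map_adj_iff.mp (hM.subset hf)
  eq_of_mem f hf f' hf' v hv hv' := Sym2.map.injective e.injective <|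
    hM.eq_of_mem _ hf _ hf' (e v) (Sym2.mem_map.mpr ⟨v, hv, rfl⟩) (Sym2.mem_map.mpr ⟨v, hv', rfl⟩)
  saturates_or a b hab :=
    (hM.saturates_or _ _ (e.map_adj_iff.mpr hab)).imp (saturates_preimage_iff e.toEquiv).mpr
      (saturates_preimage_iff e.toEquiv).mpr
  card := by
    rw [Nat.card_congr e.toEquiv, ← hM.card, ← Set.ncard_preimage_of_injective_subset_range
      e.injective (by simp [e.surjective.range_eq])]
    congr 2
    ext a
    exact saturates_preimage_iff e.toEquiv

end Transport

/-- A proper edge colouring of `G`: edges that share an end receive distinct colours. The colour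
is defined on all unordered pairs, but only its values on edges of `G` matter. -/
def IsProperEdgeColoring {V α : Type*} (G : SimpleGraph V) (c : Sym2 V → α) : Prop :=
  ∀ a b d, G.Adj a b → G.Adj a d → c s(a, b) = c s(a, d) → b = d

section EdgeColoring

variable {V W α : Type*} {G : SimpleGraph V} {H : SimpleGraph W}

theorem IsProperEdgeColoring.of_iso {c : Sym2 W → α} (hc : IsProperEdgeColoring H c)
    (e : G ≃g H) : IsProperEdgeColoring G fun p => c (p.map e) :=
  fun _ _ _ hab had h =>
    e.injective (hc _ _ _ (e.map_adj_iff.mpr hab) (e.map_adj_iff.mpr had) h)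

theorem IsProperEdgeColoring.exists_isPairing [Finite α] {c : Sym2 V → α}
    (hc : IsProperEdgeColoring G c) (hG : ∀ v, (G.neighborSet v).ncard = Nat.card α) (i : α) :
    ∃ σ, IsPairing σ ∧ ∀ a b, (G.Adj a b ∧ c s(a, b) = i) ↔ σ a = b := by
  have hsurj (a : V) : ∃ b, G.Adj a b ∧ c s(a, b) = i := by
    have hinj : Set.InjOn (fun b => c s(a, b)) (G.neighborSet a) :=
      fun b hb d hd h => hc a b d hb hd h
    have himage : (fun b => c s(a, b)) '' G.neighborSet a = Set.univ :=
      Set.eq_of_subset_of_ncard_le (Set.subset_univ _)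
        (by rw [hinj.ncard_image, hG, Set.ncard_univ])
    exact himage.ge (Set.mem_univ i)
  choose σ hadj hcolor using hsurj
  have hunique (a b : V) : (G.Adj a b ∧ c s(a, b) = i) ↔ σ a = b :=
    ⟨fun h => hc a _ b (hadj a) h.1 ((hcolor a).trans h.2.symm),
      fun h => h ▸ ⟨hadj a, hcolor a⟩⟩
  refine ⟨σ, ⟨fun a => (hunique _ _).mp ⟨(hadj a).symm, ?_⟩, fun a => (hadj a).ne'⟩, hunique⟩
  rw [Sym2.eq_swap, hcolor]

theorem isTaitColorable_iff {V : Type} {G : SimpleGraph V} (hG : IsConnectedCubic G) :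
    IsTaitColorable G ↔ ∃ c : Sym2 V → Fin 3, IsProperEdgeColoring G c := by
  constructor
  · rintro ⟨-, P, hP, hunique⟩
    choose σ _ hPσ using fun i => exists_isPairing_of_isPerfectMatching (hP i)
    choose! c hc _ using hunique
    refine ⟨c, fun a b d hab had h => ?_⟩
    have hb : (P (c s(a, b))).Adj a b := hc s(a, b) hab
    have hd : (P (c s(a, b))).Adj a d := h ▸ hc s(a, d) had
    exact ((hPσ _ _ _).mp hb).symm.trans ((hPσ _ _ _).mp hd)
  · rintro ⟨c, hc⟩
    choose σ hσ hunique using hc.exists_isPairing (by simpa using hG.2)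
    have hadj (i : Fin 3) (v : V) : G.Adj v (σ i v) := ((hunique i v _).mpr rfl).1
    refine ⟨hG, fun i => (hσ i).toSubgraph (hadj i),
      fun i => (hσ i).isPerfectMatching_toSubgraph (hadj i), Sym2.ind fun a b hab => ?_⟩
    exact ⟨c s(a, b), (hunique _ _ _).mp ⟨hab, rfl⟩, fun i hi => ((hunique i _ _).mpr hi).2.symm⟩

end EdgeColoring

section Bipartite

variable {V : Type*} {G : SimpleGraph V}

theorem IsPairing.mk_mem_range_iff {σ : V → V} (hσ : IsPairing σ) {a b : V} :
    s(a, b) ∈ Set.range (fun v => s(v, σ v)) ↔ σ a = b := by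
  constructor
  · rintro ⟨v, hv⟩
    obtain ⟨rfl, rfl⟩ | ⟨rfl, rfl⟩ := Sym2.eq_iff.mp hv
    · rfl
    · exact hσ.involutive v
  · rintro rfl
    exact ⟨a, rfl⟩

theorem IsPairing.ncard_neighborSet_deleteEdges {σ : V → V} (hσ : IsPairing σ)
    (hG : ∀ v, G.Adj v (σ v)) (a : V) :
    ((G.deleteEdges (Set.range fun v => s(v, σ v))).neighborSet a).ncard =
      (G.neighborSet a).ncard - 1 := by
  have h : (G.deleteEdges (Set.range fun v => s(v, σ v))).neighborSet a =
      G.neighborSet a \ {σ a} := by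
    ext b
    simp only [SimpleGraph.mem_neighborSet, SimpleGraph.deleteEdges_adj, hσ.mk_mem_range_iff,
      Set.mem_sdiff, Set.mem_singleton_iff, eq_comm]
  rw [h, Set.ncard_sdiff_singleton_of_mem (show σ a ∈ G.neighborSet a from hG a)]

/-- Hall's condition: the `r * #s` edges leaving `s` arrive at its neighbours, at most `r` at
each. -/
theorem ncard_le_ncard_iUnion_neighborSet [Finite V] {r : ℕ} (hr : r ≠ 0)
    (hG : ∀ v, (G.neighborSet v).ncard = r) (s : Set V) :
    s.ncard ≤ (⋃ x ∈ s, G.neighborSet x).ncard := by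
  classical
  have := Fintype.ofFinite V
  have hdegree (v : V) : #{b | G.Adj v b} = r := by
    rw [← hG v, Set.ncard_eq_toFinset_card']
    congr 1
    ext b
    simp
  have hcount := Finset.card_mul_le_card_mul G.Adj (s := s.toFinset)
    (t := (⋃ x ∈ s, G.neighborSet x).toFinset) (m := r) (n := r)
    (fun a ha => (hdegree a).symm.le.trans <| Finset.card_le_card fun b hb => by
      simp only [Finset.mem_filter_univ] at hb
      simp only [Finset.mem_bipartiteAbove, Set.mem_toFinset, Set.mem_iUnion]
      exact ⟨⟨a, Set.mem_toFinset.mp ha, hb⟩, hb⟩)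
    (fun b _ => (Finset.card_le_card fun a ha => by
      simpa using ((Finset.mem_bipartiteBelow G.Adj).mp ha).2.symm).trans (hdegree b).le)
  rw [Set.ncard_eq_toFinset_card' s, Set.ncard_eq_toFinset_card']
  exact Nat.le_of_mul_le_mul_right hcount (Nat.pos_of_ne_zero hr)

open Classical in
theorem IsProperEdgeColoring.extend_pairing {σ : V → V} (hσ : IsPairing σ) {c : Sym2 V → ℕ} {r : ℕ}
    (hc : IsProperEdgeColoring (G.deleteEdges (Set.range fun v => s(v, σ v))) c)
    (hlt : ∀ e ∈ (G.deleteEdges (Set.range fun v => s(v, σ v))).edgeSet, c e < r) :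
    IsProperEdgeColoring G fun e => if e ∈ Set.range (fun v => s(v, σ v)) then r else c e := by
  intro a b d hab had h
  have hadj {b : V} (hab : G.Adj a b) (hb : s(a, b) ∉ Set.range fun v => s(v, σ v)) :
      (G.deleteEdges (Set.range fun v => s(v, σ v))).Adj a b :=
    SimpleGraph.deleteEdges_adj.mpr ⟨hab, hb⟩
  by_cases hb : s(a, b) ∈ Set.range fun v => s(v, σ v) <;>
    by_cases hd : s(a, d) ∈ Set.range fun v => s(v, σ v) <;>
    simp only [hb, hd, if_true, if_false] at h
  · exact (hσ.mk_mem_range_iff.mp hb).symm.trans (hσ.mk_mem_range_iff.mp hd)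
  · exact absurd h (hlt _ (hadj had hd)).ne'
  · exact absurd h (hlt _ (hadj hab hb)).ne
  · exact hc a b d (hadj hab hb) (hadj had hd) h

/-- Kőnig's edge colouring theorem for regular bipartite graphs: remove perfect matchings one by
one. -/
theorem exists_isProperEdgeColoring_of_isBipartite {V : Type} [Finite V] {G : SimpleGraph V}
    (hb : G.IsBipartite) {r : ℕ} (hG : ∀ v, (G.neighborSet v).ncard = r) :
    ∃ c : Sym2 V → ℕ, IsProperEdgeColoring G c ∧ ∀ e ∈ G.edgeSet, c e < r := by
  classical
  have := Fintype.ofFinite V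
  induction r generalizing G with
  | zero =>
    have hbot (a b : V) : ¬ G.Adj a b := fun hab =>
      Set.eq_empty_iff_forall_notMem.mp ((Set.ncard_eq_zero).mp (hG a)) b hab
    exact ⟨0, fun a b _ hab => (hbot a b hab).elim, Sym2.ind fun a b hab => (hbot a b hab).elim⟩
  | succ r ih =>
    obtain ⟨_, _, hparts⟩ := hb.exists_isBipartiteWith
    obtain ⟨P, hP⟩ := SimpleGraph.exists_isPerfectMatching_of_forall_ncard_le hparts
      (ncard_le_ncard_iUnion_neighborSet r.succ_ne_zero hG)
    obtain ⟨σ, hσ, hPσ⟩ := exists_isPairing_of_isPerfectMatching hP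
    have hadj (v : V) : G.Adj v (σ v) := ((hPσ v _).mpr rfl).adj_sub
    obtain ⟨c, hc, hlt⟩ := ih (G := G.deleteEdges (Set.range fun v => s(v, σ v)))
      (hb.mono_left (G.deleteEdges_le _)) fun v => by
        rw [hσ.ncard_neighborSet_deleteEdges hadj, hG, Nat.add_sub_cancel]
    refine ⟨_, hc.extend_pairing hσ hlt, fun e he => ?_⟩
    split_ifs with h
    · exact r.lt_succ_self
    · refine (hlt e ?_).trans r.lt_succ_self
      rw [SimpleGraph.edgeSet_deleteEdges]
      exact ⟨he, h⟩

theorem isTaitColorable_of_isBipartite {V : Type} [Finite V] {G : SimpleGraph V}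
    (hG : IsConnectedCubic G) (hb : G.IsBipartite) : IsTaitColorable G := by
  obtain ⟨c, hc, hlt⟩ := exists_isProperEdgeColoring_of_isBipartite hb hG.2
  refine (isTaitColorable_iff hG).mpr ⟨fun e => Fin.ofNat 3 (c e), fun a b d hab had h => ?_⟩
  refine hc a b d hab had ?_
  rwa [Fin.ext_iff, Fin.val_ofNat, Fin.val_ofNat, Nat.mod_eq_of_lt (hlt _ hab),
    Nat.mod_eq_of_lt (hlt _ had)] at h

end Bipartite

section GeneralizedPetersen

variable {n k : ℕ}

theorem genPetersen_adj_inl_inl (hn : 1 < n) (i j : ZMod n) :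
    (genPetersen n k).Adj (.inl i) (.inl j) ↔ j = i + 1 ∨ i = j + 1 := by
  have : Fact (1 < n) := ⟨hn⟩
  simp only [genPetersen, SimpleGraph.fromRel_adj, ne_eq, Sum.inl.injEq, reduceCtorEq, and_false,
    exists_false, or_false, existsAndEq, true_and]
  refine ⟨And.right, fun h => ⟨?_, h⟩⟩
  rintro rfl
  simp at h

theorem genPetersen_adj_inl_inr (i j : ZMod n) :
    (genPetersen n k).Adj (.inl i) (.inr j) ↔ i = j := by
  simp [genPetersen, SimpleGraph.fromRel_adj, eq_comm]

theorem natCast_ne_zero_of_lt {m : ℕ} (hm : 0 < m) (hmn : m < n) : (m : ZMod n) ≠ 0 := by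
  rw [Ne, ZMod.natCast_eq_zero_iff]
  exact Nat.not_dvd_of_pos_of_lt hm hmn

theorem genPetersen_adj_inr_inr (hk : 1 ≤ k) (hkn : k < n) (i j : ZMod n) :
    (genPetersen n k).Adj (.inr i) (.inr j) ↔ j = i + k ∨ i = j + k := by
  have := natCast_ne_zero_of_lt hk hkn
  simp only [genPetersen, SimpleGraph.fromRel_adj, ne_eq, Sum.inr.injEq, reduceCtorEq, false_and,
    and_false, exists_false, false_or, existsAndEq, true_and]
  refine ⟨And.right, fun h => ⟨?_, h⟩⟩
  rintro rfl
  simp [this] at h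

theorem reachable_inl_add_natCast {H : SimpleGraph (ZMod n ⊕ ZMod n)} {i : ZMod n} {m : ℕ}
    (h : ∀ l < m, H.Adj (.inl (i + l)) (.inl (i + l + 1))) :
    H.Reachable (.inl i) (.inl (i + m)) := by
  induction m with
  | zero => simp
  | succ m ih =>
    refine (ih fun l hl => h l (by omega)).trans ?_
    simpa [add_assoc] using (h m m.lt_succ_self).reachable

theorem reachable_inl_inl [NeZero n] {H : SimpleGraph (ZMod n ⊕ ZMod n)}
    (h : ∀ i, H.Adj (.inl i) (.inl (i + 1))) (i j : ZMod n) :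
    H.Reachable (.inl i) (.inl j) := by
  simpa using reachable_inl_add_natCast (i := i) (m := (j - i).val) fun l _ => h (i + l)

theorem isConnectedCubic_genPetersen (hn : 3 ≤ n) (hk : 1 ≤ k) (hkn : k ≤ (n - 1) / 2) :
    IsConnectedCubic (genPetersen n k) := by
  have : NeZero n := ⟨by omega⟩
  have h2 : ((2 : ℕ) : ZMod n) ≠ 0 := natCast_ne_zero_of_lt (by norm_num) (by omega)
  have h2k : ((2 * k : ℕ) : ZMod n) ≠ 0 := natCast_ne_zero_of_lt (by omega) (by omega)
  push_cast at h2 h2k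
  constructor
  · have houter (i : ZMod n) : (genPetersen n k).Reachable (.inl 0) (.inl i) :=
      reachable_inl_inl (fun i => (genPetersen_adj_inl_inl (by omega) _ _).mpr (.inl rfl)) 0 i
    refine (SimpleGraph.connected_iff_exists_forall_reachable _).mpr ⟨.inl 0, ?_⟩
    rintro (i | i)
    · exact houter i
    · exact (houter i).trans ((genPetersen_adj_inl_inr i i).mpr rfl).reachable
  · rintro (i | i)
    · refine Set.ncard_eq_three.mpr
        ⟨.inl (i + 1), .inl (i - 1), .inr i, fun h => ?_, by simp, by simp, ?_⟩
      · exact h2 (by linear_combination Sum.inl.inj h)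
      · ext (j | j)
        · simp [genPetersen_adj_inl_inl (show 1 < n by omega), eq_sub_iff_add_eq, eq_comm]
        · simp [genPetersen_adj_inl_inr, eq_comm]
    · refine Set.ncard_eq_three.mpr
        ⟨.inr (i + k), .inr (i - k), .inl i, fun h => ?_, by simp, by simp, ?_⟩
      · exact h2k (by linear_combination Sum.inr.inj h)
      · ext (j | j)
        · simp [SimpleGraph.adj_comm _ (Sum.inr i), genPetersen_adj_inl_inr]
        · simp [genPetersen_adj_inr_inr hk (show k < n by omega), eq_sub_iff_add_eq, eq_comm]

theorem reachable_deleteEdges_outer (hn : 3 ≤ n) (i : ZMod n) :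
    ((genPetersen n k).deleteEdges {s(.inl i, .inl (i + 1))}).Reachable
      (.inl i) (.inl (i + 1)) := by
  have h2 : ((2 : ℕ) : ZMod n) ≠ 0 := natCast_ne_zero_of_lt (by norm_num) (by omega)
  have hend : i + 1 + ((n - 1 : ℕ) : ZMod n) = i := by
    rw [Nat.cast_sub (by omega)]
    simp
  suffices h : ((genPetersen n k).deleteEdges {s(.inl i, .inl (i + 1))}).Reachable
      (.inl (i + 1)) (.inl (i + 1 + (n - 1 : ℕ))) from (hend ▸ h).symm
  refine reachable_inl_add_natCast (m := n - 1) fun l hl => SimpleGraph.deleteEdges_adj.mpr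
    ⟨(genPetersen_adj_inl_inl (n := n) (by omega) _ _).mpr (.inl rfl), fun he => ?_⟩
  obtain ⟨h, -⟩ | ⟨h, h'⟩ := Sym2.eq_iff.mp he
  · refine natCast_ne_zero_of_lt (n := n) (m := l + 1) (by omega) (by omega) ?_
    push_cast
    linear_combination Sum.inl.inj h
  · refine h2 ?_
    push_cast
    linear_combination Sum.inl.inj h' - Sum.inl.inj h

theorem isBridgeless_genPetersen (hn : 3 ≤ n) (hk : 1 ≤ k) (hkn : k < n) :
    IsBridgeless (genPetersen n k) := by
  have : NeZero n := ⟨by omega⟩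
  have hk0 : (k : ZMod n) ≠ 0 := natCast_ne_zero_of_lt hk hkn
  refine isBridgeless_of_forall_reachable_deleteEdges
    (fun a b hab => (SimpleGraph.fromRel_adj _ a b).mp hab |>.2) ?_
  have houter (i : ZMod n) : (genPetersen n k).Adj (.inl i) (.inl (i + 1)) :=
    (genPetersen_adj_inl_inl (by omega) _ _).mpr (.inl rfl)
  have hspoke (i : ZMod n) : (genPetersen n k).Adj (.inl i) (.inr i) :=
    (genPetersen_adj_inl_inr _ _).mpr rfl
  have hinner (i : ZMod n) : (genPetersen n k).Adj (.inr i) (.inr (i + k)) :=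
    (genPetersen_adj_inr_inr hk hkn _ _).mpr (.inl rfl)
  rintro a b (⟨i, rfl, rfl⟩ | ⟨i, rfl, rfl⟩ | ⟨i, rfl, rfl⟩)
  · exact reachable_deleteEdges_outer hn i
  · have houter' (j : ZMod n) : ((genPetersen n k).deleteEdges {s(.inl i, .inr i)}).Adj
        (.inl j) (.inl (j + 1)) := SimpleGraph.deleteEdges_adj.mpr ⟨houter j, by simp⟩
    have hspoke' : ((genPetersen n k).deleteEdges {s(.inl i, .inr i)}).Adj
        (.inl (i + k)) (.inr (i + k)) :=
      SimpleGraph.deleteEdges_adj.mpr ⟨hspoke (i + k), by simp [hk0]⟩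
    have hinner' : ((genPetersen n k).deleteEdges {s(.inl i, .inr i)}).Adj
        (.inr (i + k)) (.inr i) := SimpleGraph.deleteEdges_adj.mpr ⟨(hinner i).symm, by simp⟩
    exact (reachable_inl_inl houter' i (i + k)).trans
      (hspoke'.reachable.trans hinner'.reachable)
  · have houter' (j : ZMod n) : ((genPetersen n k).deleteEdges {s(.inr i, .inr (i + k))}).Adj
        (.inl j) (.inl (j + 1)) := SimpleGraph.deleteEdges_adj.mpr ⟨houter j, by simp⟩
    have hspoke' (j : ZMod n) : ((genPetersen n k).deleteEdges {s(.inr i, .inr (i + k))}).Adj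
        (.inl j) (.inr j) := SimpleGraph.deleteEdges_adj.mpr ⟨hspoke j, by simp⟩
    exact (hspoke' i).symm.reachable.trans
      ((reachable_inl_inl houter' i (i + k)).trans (hspoke' (i + k)).reachable)

end GeneralizedPetersen

section Petersen

/-- Adjacency in the Petersen graph by cases, a decidable form of `petersen.Adj`. -/
def PetersenAdj : ZMod 5 ⊕ ZMod 5 → ZMod 5 ⊕ ZMod 5 → Prop
  | .inl i, .inl j => j = i + 1 ∨ i = j + 1
  | .inl i, .inr j => i = j
  | .inr i, .inl j => j = i
  | .inr i, .inr j => j = i + 2 ∨ i = j + 2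

instance : DecidableRel PetersenAdj
  | .inl i, .inl j => inferInstanceAs (Decidable (j = i + 1 ∨ i = j + 1))
  | .inl i, .inr j => inferInstanceAs (Decidable (i = j))
  | .inr i, .inl j => inferInstanceAs (Decidable (j = i))
  | .inr i, .inr j => inferInstanceAs (Decidable (j = i + 2 ∨ i = j + 2))

theorem petersen_adj_iff : ∀ a b, petersen.Adj a b ↔ PetersenAdj a b
  | .inl i, .inl j => genPetersen_adj_inl_inl (by norm_num) i j
  | .inl i, .inr j => genPetersen_adj_inl_inr i j
  | .inr i, .inl j => (petersen.adj_comm _ _).trans (genPetersen_adj_inl_inr j i)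
  | .inr i, .inr j => genPetersen_adj_inr_inr (by norm_num) (by norm_num) i j

theorem saturates_petersenMatching_iff (a : ZMod 5 ⊕ ZMod 5) :
    Saturates petersenMatching a ↔
      a ∈ ({.inl 1, .inr 1, .inl 3, .inl 4, .inr 0, .inr 2} : Finset (ZMod 5 ⊕ ZMod 5)) := by
  simp [Saturates, petersenMatching, or_assoc]

theorem isSparseMaximalMatching_petersenMatching :
    IsSparseMaximalMatching petersen petersenMatching where
  subset := by
    simp only [petersenMatching, Set.insert_subset_iff, Set.singleton_subset_iff,
      SimpleGraph.mem_edgeSet, petersen_adj_iff]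
    decide
  eq_of_mem := by simp +decide [petersenMatching]
  saturates_or := by
    simp only [petersen_adj_iff, saturates_petersenMatching_iff]
    decide
  card := by
    simp only [saturates_petersenMatching_iff, Finset.setOfPred_mem, Set.ncard_coe_finset,
      Nat.card_eq_fintype_card]
    decide

theorem IsProperEdgeColoring.sum_eq_zero {V : Type*} {G : SimpleGraph V} {c : Sym2 V → ZMod 3}
    (hc : IsProperEdgeColoring G c) {a b d e : V} (hab : G.Adj a b) (had : G.Adj a d)
    (hae : G.Adj a e) (hbd : b ≠ d) (hbe : b ≠ e) (hde : d ≠ e) :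
    c s(a, b) + c s(a, d) + c s(a, e) = 0 := by
  have h : ∀ p q r : ZMod 3, p ≠ q → p ≠ r → q ≠ r → p + q + r = 0 := by decide
  exact h _ _ _ (hbd ∘ hc a b d hab had) (hbe ∘ hc a b e hab hae) (hde ∘ hc a d e had hae)

theorem eq_add_sub_of_add_eq {o t : ZMod 5 → ZMod 3}
    (h : ∀ i, t (i + 2) + t i = o (i + 2) + o (i + 1)) (i : ZMod 5) :
    t i = o i + o (i + 1) - o (i + 3) := by
  have hthree : (3 : ZMod 3) = 0 := rfl
  have h₀ := h i
  have h₁ := h (i + 1)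
  have h₂ := h (i + 2)
  have h₃ := h (i + 3)
  have h₄ := h (i + 4)
  simp only [add_assoc, show (1 + 1 : ZMod 5) = 2 from rfl, show (1 + 2 : ZMod 5) = 3 from rfl,
    show (2 + 1 : ZMod 5) = 3 from rfl, show (2 + 2 : ZMod 5) = 4 from rfl,
    show (3 + 1 : ZMod 5) = 4 from rfl, show (3 + 2 : ZMod 5) = 0 from rfl,
    show (4 + 1 : ZMod 5) = 0 from rfl, show (4 + 2 : ZMod 5) = 1 from rfl, add_zero]
    at h₁ h₂ h₃ h₄
  linear_combination (t i - o i - o (i + 1) + o (i + 3)) * hthree - h₀ + h₁ + h₂ - h₃ - h₄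

/-- If there were no such `i`, the five differences `o (i + 1) - o i` would be nonzero and equal
elements of `ZMod 3`, but their sum vanishes. -/
theorem exists_eq_or_eq_of_add_eq {o t : ZMod 5 → ZMod 3}
    (h : ∀ i, t (i + 2) + t i = o (i + 2) + o (i + 1)) :
    ∃ i, o (i + 1) = o i ∨ t (i + 3) = t i := by
  by_contra! hne
  have hthree : (3 : ZMod 3) = 0 := rfl
  have hdiff (i : ZMod 5) : o (i + 4) - o (i + 3) = o (i + 1) - o i := by
    have hsign : ∀ p q : ZMod 3, p ≠ 0 → q ≠ 0 → p + q ≠ 0 → q = p := by decide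
    have hfour : i + 3 + 1 = i + 4 := by rw [add_assoc]; rfl
    have hone : i + 3 + 3 = i + 1 := by rw [add_assoc]; rfl
    refine hsign _ _ (sub_ne_zero.mpr (hne i).1) ?_ fun hsum => (hne i).2 ?_
    · exact hfour ▸ sub_ne_zero.mpr (hne (i + 3)).1
    · rw [eq_add_sub_of_add_eq h, eq_add_sub_of_add_eq h i, hfour, hone]
      linear_combination (o (i + 3) - o (i + 1)) * hthree + hsum
  have h₀ : o 4 - o 3 = o 1 - o 0 := hdiff 0
  have h₁ : o 0 - o 4 = o 2 - o 1 := hdiff 1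
  have h₃ : o 2 - o 1 = o 4 - o 3 := hdiff 3
  have h₄ : o 3 - o 2 = o 0 - o 4 := hdiff 4
  have hzero : o 1 - o 0 = 0 := by
    linear_combination 2 * (o 1 - o 0) * hthree + 4 * h₀ + 3 * h₃ + 2 * h₁ + h₄
  exact (hne 0).1 (sub_eq_zero.mp hzero)

theorem not_isProperEdgeColoring_petersen (c : Sym2 (ZMod 5 ⊕ ZMod 5) → ZMod 3) :
    ¬ IsProperEdgeColoring petersen c := by
  intro hc
  have hadj {a b} (h : PetersenAdj a b) : petersen.Adj a b := (petersen_adj_iff a b).mpr h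
  have htwo (i : ZMod 5) : i + 1 + 1 ≠ i := by decide +revert
  let o (i : ZMod 5) : ZMod 3 := c s(.inl i, .inl (i + 1))
  let t (i : ZMod 5) : ZMod 3 := c s(.inr i, .inr (i + 2))
  have houter (i : ZMod 5) : o (i + 1) + o i + c s(.inl (i + 1), .inr (i + 1)) = 0 := by
    have h := hc.sum_eq_zero (a := .inl (i + 1)) (b := .inl (i + 1 + 1)) (d := .inl i)
      (e := .inr (i + 1)) (hadj (.inl rfl)) (hadj (.inr rfl)) (hadj rfl) (by decide +revert)
      (by simp) (by simp)
    rwa [Sym2.eq_swap (b := Sum.inl i)] at h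
  have hinner (i : ZMod 5) : t (i + 2) + t i + c s(.inl (i + 2), .inr (i + 2)) = 0 := by
    have h := hc.sum_eq_zero (a := .inr (i + 2)) (b := .inr (i + 2 + 2)) (d := .inr i)
      (e := .inl (i + 2)) (hadj (.inl rfl)) (hadj (.inr rfl)) (hadj rfl) (by decide +revert)
      (by simp) (by simp)
    rwa [Sym2.eq_swap (b := Sum.inr i), Sym2.eq_swap (b := Sum.inl (i + 2))] at h
  have hadd (i : ZMod 5) : t (i + 2) + t i = o (i + 2) + o (i + 1) := by
    have h := houter (i + 1)
    rw [add_assoc i, one_add_one_eq_two] at h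
    linear_combination hinner i - h
  obtain ⟨i, h | h⟩ := exists_eq_or_eq_of_add_eq hadd
  · have := hc (.inl (i + 1)) (.inl (i + 1 + 1)) (.inl i) (hadj (.inl rfl)) (hadj (.inr rfl))
      (h.trans (congrArg c Sym2.eq_swap))
    exact htwo i (Sum.inl.inj this)
  · have hwrap : i + 3 + 2 = i := by rw [add_assoc]; exact add_zero i
    have := hc (.inr i) (.inr (i + 3)) (.inr (i + 2)) (hadj (.inr hwrap.symm)) (hadj (.inl rfl))
      ((congrArg c (by rw [hwrap, Sym2.eq_swap])).trans h)
    exact absurd this (by simp +decide)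

end Petersen

section EdgeJoin

variable {V W X : Type} {H₁ : SimpleGraph V} {H₂ : SimpleGraph W} {u v : V} {x y : W}

theorem edgeJoin_adj_inl_inl {a b : V} : (edgeJoin H₁ H₂ u v x y).Adj (.inl a) (.inl b) ↔
    H₁.Adj a b ∧ s(a, b) ≠ s(u, v) := by
  simp [edgeJoin, SimpleGraph.edge_adj]

theorem edgeJoin_adj_inr_inr {a b : W} : (edgeJoin H₁ H₂ u v x y).Adj (.inr a) (.inr b) ↔
    H₂.Adj a b ∧ s(a, b) ≠ s(x, y) := by
  simp [edgeJoin, SimpleGraph.edge_adj]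

theorem edgeJoin_adj_inl_inr {a : V} {b : W} : (edgeJoin H₁ H₂ u v x y).Adj (.inl a) (.inr b) ↔
    a = u ∧ b = y ∨ a = v ∧ b = x := by
  simp [edgeJoin, SimpleGraph.edge_adj]

theorem edgeJoin_adj_inr_inl {a : W} {b : V} : (edgeJoin H₁ H₂ u v x y).Adj (.inr a) (.inl b) ↔
    b = u ∧ a = y ∨ b = v ∧ a = x := by
  rw [SimpleGraph.adj_comm, edgeJoin_adj_inl_inr]

theorem edgeJoin_adj_left : (edgeJoin H₁ H₂ u v x y).Adj (.inl u) (.inr y) :=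
  edgeJoin_adj_inl_inr.mpr (.inl ⟨rfl, rfl⟩)

theorem edgeJoin_adj_right : (edgeJoin H₁ H₂ u v x y).Adj (.inl v) (.inr x) :=
  edgeJoin_adj_inl_inr.mpr (.inr ⟨rfl, rfl⟩)

/-- The isomorphism between the two joins of `H₁` and `H₂` in either order. -/
def edgeJoinSwap (H₁ : SimpleGraph V) (H₂ : SimpleGraph W) (u v : V) (x y : W) :
    edgeJoin H₁ H₂ u v x y ≃g edgeJoin H₂ H₁ x y u v where
  toEquiv := Equiv.sumComm V W
  map_rel_iff' := by
    rintro (a | a) (b | b) <;>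
      simp only [Equiv.sumComm_apply, Sum.swap_inl, Sum.swap_inr, edgeJoin_adj_inl_inl,
        edgeJoin_adj_inr_inr, edgeJoin_adj_inl_inr, edgeJoin_adj_inr_inl] <;>
      tauto

open Classical in
/-- The neighbour of `a` in the join that replaces the neighbour `b` of `a` in `H₁`: it is `b`
itself unless `ab` is the deleted edge `uv`. -/
def edgeJoinNeighbor (u v : V) (x y : W) (a b : V) : V ⊕ W :=
  if s(a, b) = s(u, v) then .inr (if a = u then y else x) else .inl b

theorem edgeJoinNeighbor_injective (u v : V) (x y : W) (a : V) :
    Function.Injective (edgeJoinNeighbor u v x y a) := by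
  intro b d h
  by_cases hab : s(a, b) = s(u, v) <;> by_cases had : s(a, d) = s(u, v)
  · exact Sym2.congr_right.mp (hab.trans had.symm)
  all_goals simp_all [edgeJoinNeighbor]

theorem edgeJoin_adj_inl_iff (huv : H₁.Adj u v) {a : V} {q : V ⊕ W} :
    (edgeJoin H₁ H₂ u v x y).Adj (.inl a) q ↔
      ∃ b, H₁.Adj a b ∧ edgeJoinNeighbor u v x y a b = q := by
  have hne := huv.ne'
  constructor
  · intro h
    rcases q with b | b
    · obtain ⟨hab, hdeleted⟩ := edgeJoin_adj_inl_inl.mp h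
      exact ⟨b, hab, if_neg hdeleted⟩
    · rcases edgeJoin_adj_inl_inr.mp h with ⟨rfl, rfl⟩ | ⟨rfl, rfl⟩
      · exact ⟨v, huv, by simp [edgeJoinNeighbor]⟩
      · exact ⟨u, huv.symm, by simp [edgeJoinNeighbor, hne]⟩
  · rintro ⟨b, hab, rfl⟩
    unfold edgeJoinNeighbor
    split_ifs with hdeleted ha
    · exact edgeJoin_adj_inl_inr.mpr (.inl ⟨ha, rfl⟩)
    · rcases Sym2.eq_iff.mp hdeleted with ⟨rfl, -⟩ | ⟨rfl, -⟩
      exacts [absurd rfl ha, edgeJoin_adj_right]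
    · exact edgeJoin_adj_inl_inl.mpr ⟨hab, hdeleted⟩

theorem ncard_neighborSet_edgeJoin_inl (huv : H₁.Adj u v) (a : V) :
    ((edgeJoin H₁ H₂ u v x y).neighborSet (.inl a)).ncard = (H₁.neighborSet a).ncard := by
  rw [← Set.ncard_image_of_injective _ (edgeJoinNeighbor_injective u v x y a)]
  congr 1
  ext q
  exact edgeJoin_adj_inl_iff huv

theorem ncard_neighborSet_edgeJoin {r : ℕ} (h₁ : ∀ a, (H₁.neighborSet a).ncard = r)
    (h₂ : ∀ a, (H₂.neighborSet a).ncard = r) (huv : H₁.Adj u v) (hxy : H₂.Adj x y) (p : V ⊕ W) :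
    ((edgeJoin H₁ H₂ u v x y).neighborSet p).ncard = r := by
  rcases p with a | a
  · rw [ncard_neighborSet_edgeJoin_inl huv, h₁]
  · rw [← h₂ a, ← ncard_neighborSet_edgeJoin_inl (H₂ := H₁) (x := u) (y := v) hxy a]
    exact Nat.card_congr ((edgeJoinSwap H₁ H₂ u v x y).mapNeighborSet (.inr a))

theorem IsBridgeless.reachable_of_forall_adj_ne (hb : IsBridgeless H₁) (hconn : H₁.Connected)
    {K : SimpleGraph X} {f : V → X} (hf : ∀ a b, H₁.Adj a b → s(a, b) ≠ s(u, v) → K.Adj (f a) (f b))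
    (a b : V) : K.Reachable (f a) (f b) := by
  refine reachable_of_forall_adj (fun c d hcd => ?_) (hconn.preconnected a b)
  by_cases h : s(c, d) = s(u, v)
  · refine reachable_of_forall_adj (fun c' d' hcd' => ?_) (hb.reachable_deleteEdges hcd)
    rw [SimpleGraph.deleteEdges_adj] at hcd'
    exact (hf c' d' hcd'.1 fun h' => hcd'.2 (h'.trans h.symm)).reachable
  · exact (hf c d hcd h).reachable

theorem connected_edgeJoin (b₁ : IsBridgeless H₁) (h₁ : H₁.Connected) (b₂ : IsBridgeless H₂)
    (h₂ : H₂.Connected) : (edgeJoin H₁ H₂ u v x y).Connected := by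
  have hV := b₁.reachable_of_forall_adj_ne (K := edgeJoin H₁ H₂ u v x y) (f := .inl) h₁
    fun a b hab hne => edgeJoin_adj_inl_inl.mpr ⟨hab, hne⟩
  have hW := b₂.reachable_of_forall_adj_ne (K := edgeJoin H₁ H₂ u v x y) (f := .inr) h₂
    fun a b hab hne => edgeJoin_adj_inr_inr.mpr ⟨hab, hne⟩
  have hVW (a : V) (b : W) : (edgeJoin H₁ H₂ u v x y).Reachable (.inl a) (.inr b) :=
    (hV a u).trans (edgeJoin_adj_left.reachable.trans (hW y b))
  refine { preconnected := ?_, nonempty := ⟨.inl u⟩ }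
  rintro (a | a) (b | b)
  exacts [hV a b, hVW a b, (hVW b a).symm, hW a b]

theorem reachable_deleteEdges_edgeJoin_inl_inl (b₁ : IsBridgeless H₁) (b₂ : IsBridgeless H₂)
    (h₂ : H₂.Connected) {a b : V} (hab : H₁.Adj a b) :
    ((edgeJoin H₁ H₂ u v x y).deleteEdges {s(.inl a, .inl b)}).Reachable (.inl a) (.inl b) := by
  set K := (edgeJoin H₁ H₂ u v x y).deleteEdges {s(.inl a, .inl b)} with hK
  have hxy : K.Reachable (.inr x) (.inr y) :=
    b₂.reachable_of_forall_adj_ne (u := x) (v := y) h₂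
      (fun c d hcd hne => by simpa [hK, edgeJoin_adj_inr_inr] using ⟨hcd, by simpa using hne⟩) x y
  have huy : K.Adj (.inl u) (.inr y) := by simp [hK, edgeJoin_adj_left]
  have hvx : K.Adj (.inl v) (.inr x) := by simp [hK, edgeJoin_adj_right]
  have huv : K.Reachable (.inl u) (.inl v) :=
    huy.reachable.trans (hxy.symm.trans hvx.symm.reachable)
  refine reachable_of_forall_adj (fun c d hcd => ?_) (b₁.reachable_deleteEdges hab)
  rw [SimpleGraph.deleteEdges_adj] at hcd
  by_cases h : s(c, d) = s(u, v)
  · rcases Sym2.eq_iff.mp h with ⟨rfl, rfl⟩ | ⟨rfl, rfl⟩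
    exacts [huv, huv.symm]
  · refine (SimpleGraph.deleteEdges_adj.mpr ⟨edgeJoin_adj_inl_inl.mpr ⟨hcd.1, h⟩, ?_⟩).reachable
    simpa using hcd.2

theorem reachable_deleteEdges_edgeJoin_inl_inr (b₁ : IsBridgeless H₁) (h₁ : H₁.Connected)
    (b₂ : IsBridgeless H₂) (h₂ : H₂.Connected) (huv : u ≠ v) {a : V} {b : W}
    (hab : (edgeJoin H₁ H₂ u v x y).Adj (.inl a) (.inr b)) :
    ((edgeJoin H₁ H₂ u v x y).deleteEdges {s(.inl a, .inr b)}).Reachable (.inl a) (.inr b) := by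
  set K := (edgeJoin H₁ H₂ u v x y).deleteEdges {s(.inl a, .inr b)} with hK
  have hV := b₁.reachable_of_forall_adj_ne (K := K) (f := .inl) (u := u) (v := v) h₁
    fun c d hcd hne => by simpa [hK, edgeJoin_adj_inl_inl] using ⟨hcd, by simpa using hne⟩
  have hW := b₂.reachable_of_forall_adj_ne (K := K) (f := .inr) (u := x) (v := y) h₂
    fun c d hcd hne => by simpa [hK, edgeJoin_adj_inr_inr] using ⟨hcd, by simpa using hne⟩
  rcases edgeJoin_adj_inl_inr.mp hab with ⟨rfl, rfl⟩ | ⟨rfl, rfl⟩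
  · have hvx : K.Adj (.inl v) (.inr x) := by simp [hK, edgeJoin_adj_right, huv.symm]
    exact (hV a v).trans (hvx.reachable.trans (hW x b))
  · have huy : K.Adj (.inl u) (.inr y) := by simp [hK, edgeJoin_adj_left, huv]
    exact (hV a u).trans (huy.reachable.trans (hW y b))

theorem isBridgeless_edgeJoin (b₁ : IsBridgeless H₁) (h₁ : H₁.Connected) (b₂ : IsBridgeless H₂)
    (h₂ : H₂.Connected) (huv : u ≠ v) : IsBridgeless (edgeJoin H₁ H₂ u v x y) := by
  refine isBridgeless_of_forall_reachable_deleteEdges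
    (r := fun a b => (edgeJoin H₁ H₂ u v x y).Adj a b ∧ (a.isLeft ∨ b.isRight)) ?_ ?_
  · rintro (a | a) (b | b) hab <;> simp [hab, hab.symm]
  · rintro (a | a) (b | b) ⟨hab, hside⟩
    · exact reachable_deleteEdges_edgeJoin_inl_inl b₁ b₂ h₂ (edgeJoin_adj_inl_inl.mp hab).1
    · exact reachable_deleteEdges_edgeJoin_inl_inr b₁ h₁ b₂ h₂ huv hab
    · simp at hside
    · exact reachable_deleteEdges_of_iso (edgeJoinSwap H₁ H₂ u v x y)
        (reachable_deleteEdges_edgeJoin_inl_inl b₂ b₁ h₁ (edgeJoin_adj_inr_inr.mp hab).1)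

theorem even_card_of_forall_ncard_neighborSet [Finite V] {r : ℕ} (hr : Odd r)
    (h : ∀ a, (H₁.neighborSet a).ncard = r) : Even (Nat.card V) := by
  classical
  have := Fintype.ofFinite V
  have hcount := card_interedges_self_add_compl h Finset.univ
  have hempty : H₁.interedges Finset.univ ∅ = ∅ := by simp [SimpleGraph.interedges, Rel.interedges]
  rw [Finset.compl_univ, hempty, Finset.card_empty, add_zero, Finset.card_univ] at hcount
  have heven : Even (r * Fintype.card V) := hcount ▸ even_card_interedges_self _
  rw [Nat.card_eq_fintype_card]
  exact (Nat.even_mul.mp heven).resolve_left (Nat.not_even_iff_odd.mpr hr)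

theorem IsProperEdgeColoring.edgeJoin_eq {α : Type} [Finite V] [Finite α]
    {c : Sym2 (V ⊕ W) → α} (hc : IsProperEdgeColoring (edgeJoin H₁ H₂ u v x y) c)
    (hJ : ∀ p, ((edgeJoin H₁ H₂ u v x y).neighborSet p).ncard = Nat.card α)
    (hV : Even (Nat.card V)) : c s(.inl u, .inr y) = c s(.inl v, .inr x) := by
  classical
  have := Fintype.ofFinite V
  obtain ⟨σ, hσ, hunique⟩ := hc.exists_isPairing hJ (c s(.inl u, .inr y))
  have hu : σ (.inl u) = .inr y := (hunique _ _).mp ⟨edgeJoin_adj_left, rfl⟩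
  have hodd : Odd #((Finset.univ.erase u).map (.inl : V ↪ V ⊕ W)) := by
    rw [Finset.card_map, Finset.card_erase_of_mem (Finset.mem_univ u), Finset.card_univ,
      ← Nat.card_eq_fintype_card]
    have : 0 < Nat.card V := Nat.card_pos_iff.mpr ⟨⟨u⟩, inferInstance⟩
    exact Nat.Even.sub_odd this hV odd_one
  obtain ⟨p, hp, hσp⟩ := hσ.exists_mem_notMem hodd
  obtain ⟨a, ha, rfl⟩ := Finset.mem_map.mp hp
  have hadj := (hunique (.inl a) _).mpr rfl
  rcases hq : σ (.inl a) with b | b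
  · have hb : b = u := by simpa [hq] using hσp
    have := hσ.involutive (.inl a)
    rw [hq, hb, hu] at this
    cases this
  · rw [hq] at hadj
    rcases edgeJoin_adj_inl_inr.mp hadj.1 with ⟨rfl, -⟩ | ⟨rfl, rfl⟩
    · simp at ha
    · exact hadj.2.symm

theorem IsProperEdgeColoring.of_edgeJoin {α : Type} [Finite V] [Finite α]
    {c : Sym2 (V ⊕ W) → α} (hc : IsProperEdgeColoring (edgeJoin H₁ H₂ u v x y) c)
    (hJ : ∀ p, ((edgeJoin H₁ H₂ u v x y).neighborSet p).ncard = Nat.card α)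
    (hV : Even (Nat.card V)) (huv : H₁.Adj u v) : ∃ d : Sym2 V → α, IsProperEdgeColoring H₁ d := by
  classical
  let d : Sym2 V → α := fun e => if e = s(u, v) then c s(.inl u, .inr y) else c (e.map .inl)
  have hd (a b : V) : d s(a, b) = c s(.inl a, edgeJoinNeighbor u v x y a b) := by
    simp only [d, edgeJoinNeighbor]
    split_ifs with hab ha
    · rw [ha]
    · rcases Sym2.eq_iff.mp hab with ⟨rfl, -⟩ | ⟨rfl, -⟩
      exacts [absurd rfl ha, hc.edgeJoin_eq hJ hV]
    · rfl
  refine ⟨d, fun a b b' hab hab' h => edgeJoinNeighbor_injective u v x y a ?_⟩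
  rw [hd, hd] at h
  exact hc _ _ _ ((edgeJoin_adj_inl_iff huv).mpr ⟨b, hab, rfl⟩)
    ((edgeJoin_adj_inl_iff huv).mpr ⟨b', hab', rfl⟩) h

end EdgeJoin

section SnarkFamily

variable {V W : Type} {H : SimpleGraph V} {H₁ : SimpleGraph V} {H₂ : SimpleGraph W} {u v : V}
  {x y : W} {M M₁ : Set (Sym2 V)} {M₂ : Set (Sym2 W)}

theorem saturates_union_iff {M N : Set (Sym2 V)} {a : V} :
    Saturates (M ∪ N) a ↔ Saturates M a ∨ Saturates N a := by
  simp [Saturates, or_and_right, exists_or]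

theorem saturates_image_iff {f : V → W} {b : W} :
    Saturates (Sym2.map f '' M) b ↔ ∃ a, Saturates M a ∧ f a = b := by
  constructor
  · rintro ⟨_, ⟨e, he, rfl⟩, hb⟩
    obtain ⟨a, ha, rfl⟩ := Sym2.mem_map.mp hb
    exact ⟨a, ⟨e, he, ha⟩, rfl⟩
  · rintro ⟨a, ⟨e, he, ha⟩, rfl⟩
    exact ⟨_, ⟨e, he, rfl⟩, Sym2.mem_map.mpr ⟨a, ha, rfl⟩⟩

theorem IsEdgeMatching.join (h₁ : IsEdgeMatching H₁ M₁) (h₂ : IsEdgeMatching H₂ M₂)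
    (huv : s(u, v) ∉ M₁) (hxy : s(x, y) ∉ M₂) :
    IsEdgeMatching (edgeJoin H₁ H₂ u v x y)
      (Sym2.map Sum.inl '' M₁ ∪ Sym2.map Sum.inr '' M₂) where
  subset := by
    rintro _ (⟨⟨a, b⟩, he, rfl⟩ | ⟨⟨a, b⟩, he, rfl⟩)
    · exact edgeJoin_adj_inl_inl.mpr ⟨h₁.subset he, fun h => huv (h ▸ he)⟩
    · exact edgeJoin_adj_inr_inr.mpr ⟨h₂.subset he, fun h => hxy (h ▸ he)⟩
  eq_of_mem := by
    rintro _ (⟨e, he, rfl⟩ | ⟨e, he, rfl⟩) _ (⟨f, hf, rfl⟩ | ⟨f, hf, rfl⟩) p hp hp' <;>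
    obtain ⟨a, ha, rfl⟩ := Sym2.mem_map.mp hp <;>
    obtain ⟨b, hb, hba⟩ := Sym2.mem_map.mp hp' <;> cases hba
    · rw [h₁.eq_of_mem e he f hf _ ha hb]
    · rw [h₂.eq_of_mem e he f hf _ ha hb]

theorem IsSparseMaximalMatching.join [Finite V] [Finite W]
    (h₁ : IsSparseMaximalMatching H₁ M₁) (h₂ : IsSparseMaximalMatching H₂ M₂)
    (huv : s(u, v) ∉ M₁) (hu : Saturates M₁ u) (hxy : s(x, y) ∉ M₂) (hx : Saturates M₂ x) :
    IsSparseMaximalMatching (edgeJoin H₁ H₂ u v x y)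
      (Sym2.map Sum.inl '' M₁ ∪ Sym2.map Sum.inr '' M₂) where
  toIsEdgeMatching := h₁.toIsEdgeMatching.join h₂.toIsEdgeMatching huv hxy
  saturates_or := by
    have hcross (a : V) (b : W) (hab : (edgeJoin H₁ H₂ u v x y).Adj (.inl a) (.inr b)) :
        Saturates M₁ a ∨ Saturates M₂ b := by
      rcases edgeJoin_adj_inl_inr.mp hab with ⟨rfl, rfl⟩ | ⟨rfl, rfl⟩
      exacts [.inl hu, .inr hx]
    rintro (a | a) (b | b) hab <;> simp only [saturates_union_iff, saturates_image_iff,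
      Sum.inl.injEq, Sum.inr.injEq, reduceCtorEq, and_false, exists_false, or_false, false_or,
      exists_eq_right]
    · exact h₁.saturates_or a b (edgeJoin_adj_inl_inl.mp hab).1
    · exact hcross a b hab
    · exact (hcross b a hab.symm).symm
    · exact h₂.saturates_or a b (edgeJoin_adj_inr_inr.mp hab).1
  card := by
    have hset : {p | Saturates (Sym2.map Sum.inl '' M₁ ∪ Sym2.map Sum.inr '' M₂) p} =
        Sum.inl '' {a | Saturates M₁ a} ∪ Sum.inr '' {a | Saturates M₂ a} :=
      Set.ext fun p => saturates_union_iff.trans (or_congr saturates_image_iff saturates_image_iff)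
    rw [hset, Set.ncard_union_eq Set.disjoint_image_inl_image_inr,
      Set.ncard_image_of_injective _ Sum.inl_injective,
      Set.ncard_image_of_injective _ Sum.inr_injective, Nat.card_sum, mul_add, mul_add,
      h₁.card, h₂.card]

/-- A snark together with a matching that certifies `η ≤ 1/3`: what the construction of the
Petersen snark family preserves. Non-colorability is expressed through edge colourings. -/
structure IsSparseSnark (H : SimpleGraph V) (M : Set (Sym2 V)) : Prop where
  finite : Finite V
  cubic : IsConnectedCubic H
  bridgeless : IsBridgeless H
  not_colorable : ∀ c : Sym2 V → Fin 3, ¬ IsProperEdgeColoring H c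
  sparse : IsSparseMaximalMatching H M

theorem IsSparseSnark.join (h₁ : IsSparseSnark H₁ M₁) (h₂ : IsSparseSnark H₂ M₂)
    (huv : H₁.Adj u v) (huvM : s(u, v) ∉ M₁) (hu : Saturates M₁ u)
    (hxy : H₂.Adj x y) (hxyM : s(x, y) ∉ M₂) (hx : Saturates M₂ x) :
    IsSparseSnark (edgeJoin H₁ H₂ u v x y)
      (Sym2.map Sum.inl '' M₁ ∪ Sym2.map Sum.inr '' M₂) := by
  have := h₁.finite
  have := h₂.finite
  have hdegree := ncard_neighborSet_edgeJoin h₁.cubic.2 h₂.cubic.2 huv hxy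
  refine ⟨inferInstance,
    ⟨connected_edgeJoin h₁.bridgeless h₁.cubic.1 h₂.bridgeless h₂.cubic.1, hdegree⟩,
    isBridgeless_edgeJoin h₁.bridgeless h₁.cubic.1 h₂.bridgeless h₂.cubic.1 huv.ne,
    fun c hc => ?_, h₁.sparse.join h₂.sparse huvM hu hxyM hx⟩
  have heven := even_card_of_forall_ncard_neighborSet (by decide) h₁.cubic.2
  obtain ⟨d, hd⟩ := hc.of_edgeJoin (by simpa using hdegree) heven huv
  exact h₁.not_colorable d hd

theorem Constructed.isSparseSnark (h : Constructed H M) : IsSparseSnark H M := by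
  induction h with
  | base =>
    exact ⟨inferInstance, isConnectedCubic_genPetersen (by norm_num) (by norm_num) (by norm_num),
      isBridgeless_genPetersen (by norm_num) (by norm_num) (by norm_num),
      not_isProperEdgeColoring_petersen, isSparseMaximalMatching_petersenMatching⟩
  | join _ _ huv huvM hu _ hxy hxyM hx _ ih₁ ih₂ =>
    exact ih₁.join ih₂ huv huvM hu hxy hxyM hx

theorem IsSparseSnark.exists_boundary_edge (h : IsSparseSnark H M) :
    ∃ u v, H.Adj u v ∧ s(u, v) ∉ M ∧ Saturates M u ∧ ¬ Saturates M v := by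
  have := h.finite
  have := h.cubic.1.nonempty
  obtain ⟨v, hv⟩ : ∃ v, ¬ Saturates M v := by
    by_contra! hall
    have hcard := h.sparse.card
    rw [Set.eq_univ_of_forall (s := {v | Saturates M v}) hall, Set.ncard_univ] at hcard
    have : 0 < Nat.card V := Nat.card_pos
    lia
  obtain ⟨u, hvu⟩ : (H.neighborSet v).Nonempty := by
    rw [← Set.ncard_pos, h.cubic.2]
    norm_num
  exact ⟨u, v, hvu.symm, fun huvM => hv (saturates_of_mem (Sym2.eq_swap ▸ huvM)),
    (h.sparse.saturates_or v u hvu).resolve_left hv, hv⟩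

theorem exists_constructed_card_ge (N : ℕ) :
    ∃ (V : Type) (H : SimpleGraph V) (M : Set (Sym2 V)), Constructed H M ∧ N ≤ Nat.card V := by
  induction N with
  | zero => exact ⟨_, _, _, .base, Nat.zero_le _⟩
  | succ N ih =>
    obtain ⟨V, H, M, h, hN⟩ := ih
    have := h.isSparseSnark.finite
    obtain ⟨u, v, huv, huvM, hu, hv⟩ := h.isSparseSnark.exists_boundary_edge
    obtain ⟨x, y, hxy, hxyM, hx, hy⟩ := Constructed.base.isSparseSnark.exists_boundary_edge
    refine ⟨_, _, _, .join h .base huv huvM hu hv hxy hxyM hx hy, ?_⟩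
    rw [Nat.card_sum]
    have : 0 < Nat.card (ZMod 5 ⊕ ZMod 5) := Nat.card_pos
    lia

theorem exists_mem_petersenSnarkFamily_card_ge (N : ℕ) :
    ∃ G ∈ petersenSnarkFamily, N ≤ Fintype.card G.V := by
  classical
  obtain ⟨V, H, M, h, hN⟩ := exists_constructed_card_ge N
  have := h.isSparseSnark.finite
  have := Fintype.ofFinite V
  rw [Nat.card_eq_fintype_card] at hN
  exact ⟨⟨V, H⟩, ⟨V, H, M, h, ⟨.refl⟩⟩, hN⟩

theorem isSnark_and_eta_of_mem_petersenSnarkFamily {G : FinGraph} (hG : G ∈ petersenSnarkFamily) :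
    IsSnark G.graph ∧ eta G.graph = 1 / 3 := by
  obtain ⟨V, H, M, h, ⟨e⟩⟩ := hG
  have hsnark := h.isSparseSnark
  have hcubic := hsnark.cubic.of_iso e
  have hbridgeless := hsnark.bridgeless.of_iso e
  have := hcubic.1.nonempty
  refine ⟨⟨hcubic, hbridgeless, fun hT => ?_⟩,
    le_antisymm (hsnark.sparse.of_iso e).eta_le (hbridgeless.third_le_eta hcubic)⟩
  obtain ⟨c, hc⟩ := (isTaitColorable_iff hcubic).mp hT
  exact hsnark.not_colorable _ (hc.of_iso e.symm)

end SnarkFamily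

section Classes

variable {C : Set FinGraph} {r : ℝ} {G : FinGraph}

theorem classEtaEq_of_forall (h : ∀ G ∈ C, r ≤ eta G.graph) (hG : G ∈ C) (hr : eta G.graph ≤ r) :
    ClassEtaEq C r := by
  have hleast : IsLeast ((fun G : FinGraph => eta G.graph) '' C) r :=
    ⟨⟨G, hG, le_antisymm hr (h G hG)⟩, Set.forall_mem_image.mpr h⟩
  exact ⟨hleast.csInf_eq, hleast⟩

theorem classEtaEq_petersenSnarkFamily : ClassEtaEq petersenSnarkFamily (1 / 3) := by
  obtain ⟨G, hG, -⟩ := exists_mem_petersenSnarkFamily_card_ge 0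
  exact classEtaEq_of_forall (fun G hG => (isSnark_and_eta_of_mem_petersenSnarkFamily hG).2.ge) hG
    (isSnark_and_eta_of_mem_petersenSnarkFamily hG).2.le

theorem classEtaEq_generalizedPetersenGraphs : ClassEtaEq generalizedPetersenGraphs (1 / 3) := by
  refine classEtaEq_of_forall (G := ⟨_, petersen⟩) ?_
    ⟨5, 2, by norm_num, by norm_num, by norm_num, ⟨.refl⟩⟩
    isSparseMaximalMatching_petersenMatching.eta_le
  rintro G ⟨n, k, hn, hk, hkn, ⟨e⟩⟩
  exact ((isBridgeless_genPetersen hn hk (by lia)).of_iso e).third_le_eta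
    ((isConnectedCubic_genPetersen hn hk hkn).of_iso e)

end Classes

section StraightLine

variable {R : Type*} [CommRing R]

/-- Twice the signed area of the triangle `p q r`. -/
def orient (p q r : R × R) : R :=
  (q.1 - p.1) * (r.2 - p.2) - (q.2 - p.2) * (r.1 - p.1)

/-- The points `r` and `s` are on the same side of the line through `p` and `q`, where one of them,
but not both, may be on the line itself. -/
def OnOneSide [LE R] (p q r s : R × R) : Prop :=
  0 ≤ orient p q r * orient p q s ∧ ¬ (orient p q r = 0 ∧ orient p q s = 0)

instance (p q r s : ℤ × ℤ) : Decidable (OnOneSide p q r s) :=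
  inferInstanceAs (Decidable (_ ∧ _))

theorem orient_lineMap (p q r s : R × R) (t : R) :
    orient p q (AffineMap.lineMap r s t) = (1 - t) * orient p q r + t * orient p q s := by
  simp only [orient, AffineMap.lineMap_apply, vsub_eq_sub, vadd_eq_add, Prod.fst_add, Prod.snd_add,
    Prod.smul_fst, Prod.smul_snd, Prod.fst_sub, Prod.snd_sub, smul_eq_mul]
  ring

theorem orient_lineMap_self (p q : R × R) (t : R) : orient p q (AffineMap.lineMap p q t) = 0 := by
  simp only [orient, AffineMap.lineMap_apply, vsub_eq_sub, vadd_eq_add, Prod.fst_add, Prod.snd_add,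
    Prod.smul_fst, Prod.smul_snd, Prod.fst_sub, Prod.snd_sub, smul_eq_mul]
  ring

theorem OnOneSide.lineMap_ne [LinearOrder R] [IsStrictOrderedRing R] {p q r s : R × R}
    (h : OnOneSide p q r s) {t t' : R} (ht' : t' ∈ Set.Ioo 0 1) :
    AffineMap.lineMap p q t ≠ AffineMap.lineMap r s t' := by
  intro heq
  have hzero := orient_lineMap p q r s t'
  rw [← heq, orient_lineMap_self] at hzero
  have ht0 := ht'.1
  have ht1 : 0 < 1 - t' := sub_pos.mpr ht'.2
  obtain ⟨hnonneg, hne⟩ := h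
  have hr : orient p q r = 0 := by
    have hsum : (1 - t') * orient p q r ^ 2 + t' * (orient p q r * orient p q s) = 0 := by
      linear_combination -orient p q r * hzero
    have hfirst := ((add_eq_zero_iff_of_nonneg (by positivity) (by positivity)).mp hsum).1
    simpa [ht1.ne'] using hfirst
  refine hne ⟨hr, ?_⟩
  simpa [hr, ht0.ne'] using hzero.symm

theorem orient_map {S : Type*} [CommRing S] (f : R →+* S) (p q r : R × R) :
    orient (p.map f f) (q.map f f) (r.map f f) = f (orient p q r) := by
  simp [orient]

theorem OnOneSide.map {S : Type*} [CommRing S] [LinearOrder R] [LinearOrder S] {f : R →+* S}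
    (hf : StrictMono f) {p q r s : R × R} (h : OnOneSide p q r s) :
    OnOneSide (p.map f f) (q.map f f) (r.map f f) (s.map f f) := by
  simpa only [OnOneSide, orient_map, ← map_mul, ← map_zero f, hf.le_iff_le, hf.injective.eq_iff]
    using h

variable {V : Type} {G : SimpleGraph V}

theorem isPlanar_of_straightLine {P : V → ℝ × ℝ} (hP : Function.Injective P)
    (hvertex : ∀ a b, G.Adj a b → ∀ v, v ≠ a → v ≠ b → orient (P a) (P b) (P v) ≠ 0)
    (hedge : ∀ a b, G.Adj a b → ∀ c d, G.Adj c d → s(a, b) ≠ s(c, d) →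
      OnOneSide (P a) (P b) (P c) (P d) ∨ OnOneSide (P c) (P d) (P a) (P b)) : IsPlanar G := by
  choose u v huv using fun e : G.edgeSet => e.1.ind (f := fun e => ∃ u v, e = s(u, v))
    fun u v => ⟨u, v, rfl⟩
  have hadj (e : G.edgeSet) : G.Adj (u e) (v e) := by
    rw [← SimpleGraph.mem_edgeSet, ← huv e]
    exact e.2
  have hinj (e : G.edgeSet) := AffineMap.lineMap_injective ℝ (hP.ne (hadj e).ne)
  refine ⟨{
    pos := P
    pos_injective := hP
    arc := fun e t => AffineMap.lineMap (P (u e)) (P (v e)) (t : ℝ)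
    arc_continuous := fun e => AffineMap.lineMap_continuous.comp continuous_subtype_val
    arc_injective := fun e => (hinj e).comp Subtype.val_injective
    arc_ends := fun e => ⟨u e, v e, huv e, by simp, by simp⟩
    arc_ne_pos := fun e t ht w h => ?_
    arc_ne_arc := fun e f hef s hs t ht h => ?_ }⟩
  · have hu : w ≠ u e := by
      rintro rfl
      refine ht.1.ne' (Subtype.ext (hinj e ?_))
      simpa using h
    have hv : w ≠ v e := by
      rintro rfl
      refine ht.2.ne (Subtype.ext (hinj e ?_))
      simpa using h
    exact hvertex _ _ (hadj e) w hu hv (h ▸ orient_lineMap_self _ _ _)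
  · have hne : s(u e, v e) ≠ s(u f, v f) := by
      rw [← huv e, ← huv f]
      exact fun h => hef (Subtype.ext h)
    rcases hedge _ _ (hadj e) _ _ (hadj f) hne with hside | hside
    · exact hside.lineMap_ne ⟨ht.1, ht.2⟩ h
    · exact hside.lineMap_ne ⟨hs.1, hs.2⟩ h.symm

theorem isPlanar_of_straightLine_int {P : V → ℤ × ℤ} (hP : Function.Injective P)
    (hvertex : ∀ a b, G.Adj a b → ∀ v, v ≠ a → v ≠ b → orient (P a) (P b) (P v) ≠ 0)
    (hedge : ∀ a b, G.Adj a b → ∀ c d, G.Adj c d → s(a, b) ≠ s(c, d) →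
      OnOneSide (P a) (P b) (P c) (P d) ∨ OnOneSide (P c) (P d) (P a) (P b)) : IsPlanar G := by
  have hcast : StrictMono (Int.castRingHom ℝ) := Int.cast_strictMono
  refine isPlanar_of_straightLine (P := fun v => (P v).map (Int.castRingHom ℝ) (Int.castRingHom ℝ))
    ((hcast.injective.prodMap hcast.injective).comp hP) (fun a b hab v hva hvb => ?_)
    fun a b hab c d hcd hne => (hedge a b hab c d hcd hne).imp (.map hcast) (.map hcast)
  rw [orient_map]
  exact (map_ne_zero_iff _ hcast.injective).mpr (hvertex a b hab v hva hvb)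

end StraightLine

section ChordGraph

/-- The other ends of the chords of the Hamiltonian cycle `0, 1, …, 9` in `chordGraph`. -/
def chord : Fin 10 → Fin 10 := ![4, 9, 7, 5, 0, 3, 8, 2, 6, 1]

/-- A planar hamiltonian cubic graph with a sparse maximal matching: the edges of a tetrahedron with
vertices `0, 2, 5, 8` are subdivided, and the new vertices are matched along common faces. -/
def chordGraph : SimpleGraph (Fin 10) where
  Adj a b := b = a + 1 ∨ a = b + 1 ∨ b = chord a
  symm := ⟨by decide⟩
  loopless := ⟨by decide⟩

instance : DecidableRel chordGraph.Adj := fun a b =>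
  inferInstanceAs (Decidable (b = a + 1 ∨ a = b + 1 ∨ b = chord a))

theorem isHamiltonian_chordGraph : chordGraph.IsHamiltonian :=
  SimpleGraph.IsHamiltonian.mono (G := SimpleGraph.cycleGraph (7 + 3))
    (fun a b => by decide +revert) fun _ =>
      ⟨0, SimpleGraph.cycleGraph.cycle 7,
        SimpleGraph.Walk.isHamiltonianCycle_iff_isCycle_and_length_eq.mpr
          ⟨SimpleGraph.cycleGraph.isCycle_cycle, by simp⟩⟩

theorem isConnectedCubic_chordGraph : IsConnectedCubic chordGraph := by
  refine ⟨isHamiltonian_chordGraph.connected, fun v => ?_⟩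
  rw [Set.ncard_eq_toFinset_card']
  decide +revert

/-- The colour `2` on the chords, and `0` and `1` alternately on the Hamiltonian cycle. -/
def chordGraphColoring : Sym2 (Fin 10) → Fin 3 :=
  Sym2.lift ⟨fun a b => if b = chord a then 2
    else if b = a + 1 ∧ Even a.val ∨ a = b + 1 ∧ Even b.val then 0 else 1, by decide⟩

theorem isProperEdgeColoring_chordGraph : IsProperEdgeColoring chordGraph chordGraphColoring := by
  unfold IsProperEdgeColoring
  decide

theorem isTaitColorable_chordGraph : IsTaitColorable chordGraph :=
  (isTaitColorable_iff isConnectedCubic_chordGraph).mpr ⟨_, isProperEdgeColoring_chordGraph⟩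

theorem saturates_chordGraph_iff (a : Fin 10) :
    Saturates {s(1, 9), s(3, 4), s(6, 7)} a ↔ a ∈ ({1, 9, 3, 4, 6, 7} : Finset (Fin 10)) := by
  simp [Saturates, or_assoc]

theorem isSparseMaximalMatching_chordGraph :
    IsSparseMaximalMatching chordGraph {s(1, 9), s(3, 4), s(6, 7)} where
  subset := by
    simp only [Set.insert_subset_iff, Set.singleton_subset_iff, SimpleGraph.mem_edgeSet]
    decide
  eq_of_mem := by simp +decide
  saturates_or := by
    simp only [saturates_chordGraph_iff]
    decide
  card := by
    simp only [saturates_chordGraph_iff, Finset.setOfPred_mem, Set.ncard_coe_finset,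
      Nat.card_eq_fintype_card]
    decide

theorem isPlanar_chordGraph : IsPlanar chordGraph :=
  isPlanar_of_straightLine_int
    (P := ![(8, 4), (5, 8), (1, 6), (1, 2), (5, 0), (2, 2), (4, 4), (2, 6), (4, 5), (6, 5)])
    (by decide) (by decide) (by decide)

end ChordGraph

section HamiltonianComplement

variable {V : Type*} {G : SimpleGraph V}

theorem exists_isPairing_connected_deleteEdges [Fintype V] [DecidableEq V]
    (hG : ∀ v, (G.neighborSet v).ncard = 3) (hham : G.IsHamiltonian) :
    ∃ σ, IsPairing σ ∧ (∀ v, G.Adj v (σ v)) ∧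
      (G.deleteEdges (Set.range fun v => s(v, σ v))).Connected := by
  have hcard : Fintype.card V ≠ 1 := fun h => by
    obtain ⟨v, -⟩ := Fintype.card_eq_one_iff.mp h
    have := Set.ncard_le_card (G.neighborSet v)
    rw [hG, Nat.card_eq_fintype_card] at this
    omega
  obtain ⟨r, cycle, hcycle⟩ := hham hcard
  have hunique (v : V) : ∃ b, G.neighborSet v \ cycle.toSubgraph.neighborSet v = {b} := by
    rw [← Set.ncard_eq_one, Set.ncard_sdiff (cycle.toSubgraph.neighborSet_subset v), hG,
      hcycle.isCycle.ncard_neighborSet_toSubgraph_eq_two (hcycle.mem_support v)]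
  choose σ hσ using hunique
  have hiff (a b : V) : σ a = b ↔ G.Adj a b ∧ s(a, b) ∉ cycle.edges := by
    rw [← cycle.adj_toSubgraph_iff_mem_edges, eq_comm, ← Set.mem_singleton_iff, ← hσ]
    rfl
  have hadj (v : V) : G.Adj v (σ v) ∧ s(v, σ v) ∉ cycle.edges := (hiff v _).mp rfl
  refine ⟨σ, ⟨fun v => (hiff _ _).mpr ⟨(hadj v).1.symm, Sym2.eq_swap ▸ (hadj v).2⟩,
    fun v => (hadj v).1.ne'⟩, fun v => (hadj v).1, ?_⟩
  let walk := cycle.toDeleteEdges (Set.range fun v => s(v, σ v)) <| by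
    rintro _ he ⟨v, rfl⟩
    exact (hadj v).2 he
  rw [SimpleGraph.connected_iff_exists_forall_reachable]
  refine ⟨r, fun v => ⟨walk.takeUntil v ?_⟩⟩
  simpa [walk, SimpleGraph.Walk.toDeleteEdges] using hcycle.mem_support v

theorem connected_of_forall_exists_adj_lt {root : V} {depth : V → ℕ}
    (h : ∀ v, v ≠ root → ∃ w, G.Adj v w ∧ depth w < depth v) : G.Connected := by
  rw [SimpleGraph.connected_iff_exists_forall_reachable]
  refine ⟨root, fun v => ?_⟩
  induction hn : depth v using Nat.strong_induction_on generalizing v with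
  | h n ih =>
    by_cases hv : v = root
    · rw [hv]
    · obtain ⟨w, hvw, hlt⟩ := h v hv
      exact (ih _ (hn ▸ hlt) w rfl).trans hvw.symm.reachable

end HamiltonianComplement

section TripleLink

/-- Adjacency in `tripleLink`. -/
def tripleLinkAdj : Bool ⊕ (Fin 3 × Bool × Fin 3) → Bool ⊕ (Fin 3 × Bool × Fin 3) → Bool
  | .inl _, .inl _ => false
  | .inl s, .inr (_, t, j) => s = t ∧ j = 0
  | .inr (_, t, j), .inl s => s = t ∧ j = 0
  | .inr (i, s, j), .inr (k, t, l) => i = k ∧ s ≠ t ∧ ¬ (j = 0 ∧ l = 0)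

/-- A bipartite nonhamiltonian cubic graph: two hubs `Sum.inl false`, `Sum.inl true` are linked by
three copies of `K₃,₃` minus an edge. The ends of the missing edge of copy `i`, which are adjacent
to the hubs, are the vertices `Sum.inr (i, _, 0)`. -/
def tripleLink : SimpleGraph (Bool ⊕ (Fin 3 × Bool × Fin 3)) where
  Adj a b := tripleLinkAdj a b
  symm := ⟨by decide⟩
  loopless := ⟨by decide⟩

instance : DecidableRel tripleLink.Adj := fun a b =>
  inferInstanceAs (Decidable (tripleLinkAdj a b))

/-- The distance from `Sum.inl false` in `tripleLink`. -/
def tripleLinkDepth : Bool ⊕ (Fin 3 × Bool × Fin 3) → ℕ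
  | .inl false => 0
  | .inr (_, false, 0) => 1
  | .inr (_, true, 1) | .inr (_, true, 2) => 2
  | .inr (_, false, 1) | .inr (_, false, 2) => 3
  | .inr (_, true, 0) => 4
  | .inl true => 5

theorem isConnectedCubic_tripleLink : IsConnectedCubic tripleLink := by
  refine ⟨connected_of_forall_exists_adj_lt (root := .inl false) (depth := tripleLinkDepth)
    (by decide), fun v => ?_⟩
  rw [Set.ncard_eq_toFinset_card']
  decide +revert

theorem isBipartite_tripleLink : tripleLink.IsBipartite := by
  have hcolorable := (SimpleGraph.Coloring.mk (G := tripleLink)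
    (Sum.elim (fun s => !s) fun p => p.2.1) (by decide)).colorable
  rwa [Fintype.card_bool] at hcolorable

/-- If the hub were not the partner of `Sum.inr (i, true, 0)`, then the three vertices
`Sum.inr (i, true, _)` would be matched with all three vertices `Sum.inr (i, false, _)`. -/
theorem apply_hub_of_isPairing {σ : Bool ⊕ (Fin 3 × Bool × Fin 3) → Bool ⊕ (Fin 3 × Bool × Fin 3)}
    (hσ : IsPairing σ) (hadj : ∀ v, tripleLink.Adj v (σ v)) {i : Fin 3}
    (h : σ (.inl false) = .inr (i, false, 0)) : σ (.inl true) = .inr (i, true, 0) := by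
  suffices hend : σ (.inr (i, true, 0)) = .inl true by rw [← hend, hσ.involutive]
  by_contra hend
  have hneighbors : ∀ i j v, tripleLink.Adj (.inr (i, true, j)) v →
      (∃ l, v = .inr (i, false, l)) ∨ j = 0 ∧ v = .inl true := by
    decide
  have hinside (j : Fin 3) : ∃ l, σ (.inr (i, true, j)) = .inr (i, false, l) :=
    (hneighbors i j _ (hadj _)).resolve_right fun ⟨hj, hub⟩ => hend (hj ▸ hub)
  choose f hf using hinside
  have hinj : Function.Injective f := fun j l hjl => by
    have := hσ.involutive.injective ((hf j).trans ((hf l).trans (by rw [hjl])).symm)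
    simpa using this
  obtain ⟨j, hj⟩ := Finite.surjective_of_injective hinj 0
  have := hσ.involutive.injective ((hf j).trans (hj ▸ h.symm))
  simp at this

theorem not_isHamiltonian_tripleLink : ¬ tripleLink.IsHamiltonian := by
  intro hham
  obtain ⟨σ, hσ, hadj, hconn⟩ :=
    exists_isPairing_connected_deleteEdges isConnectedCubic_tripleLink.2 hham
  have hhub : ∀ v, tripleLink.Adj (.inl false) v → ∃ i, v = .inr (i, false, 0) := by decide
  obtain ⟨i, hfalse⟩ := hhub _ (hadj _)
  have htrue := apply_hub_of_isPairing hσ hadj hfalse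
  have hleave : ∀ i p v, tripleLink.Adj (.inr (i, p)) v → (∀ q, v ≠ .inr (i, q)) →
      p = (false, 0) ∧ v = .inl false ∨ p = (true, 0) ∧ v = .inl true := by decide
  obtain ⟨walk⟩ := hconn (.inr (i, false, 0)) (.inl false)
  obtain ⟨d, -, ⟨p, hfst⟩, hsnd⟩ :=
    walk.exists_boundary_dart (Set.range fun p => .inr (i, p)) ⟨_, rfl⟩ (by simp)
  obtain ⟨hd, hnotMem⟩ := SimpleGraph.deleteEdges_adj.mp d.adj
  rw [Sym2.eq_swap, hσ.mk_mem_range_iff, ← hfst] at hnotMem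
  rw [← hfst] at hd
  rcases hleave i p _ hd fun q hq => hsnd ⟨q, hq.symm⟩ with ⟨rfl, hv⟩ | ⟨rfl, hv⟩
  · exact hnotMem (hv ▸ hfalse)
  · exact hnotMem (hv ▸ htrue)

theorem eta_tripleLink_le : eta tripleLink ≤ 1 / 2 :=
  eta_le_half_of_disjoint_edges (a := .inl false) (b := .inr (0, false, 0)) (c := .inl true)
    (d := .inr (1, true, 0)) (by decide) (by decide) (by decide) (by decide) (by decide)
    (by decide) fun _ hσ hadj h => by simp [apply_hub_of_isPairing hσ hadj h]

end TripleLink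

section Classes

theorem classEtaEq_taitColorableGraphs : ClassEtaEq taitColorableGraphs (1 / 3) :=
  classEtaEq_of_forall (G := ⟨_, chordGraph⟩) (fun _ h => IsTaitColorable.third_le_eta h)
    isTaitColorable_chordGraph isSparseMaximalMatching_chordGraph.eta_le

theorem classEtaEq_planarBridgelessCubicGraphs :
    ClassEtaEq planarBridgelessCubicGraphs (1 / 3) :=
  classEtaEq_of_forall (G := ⟨_, chordGraph⟩) (fun _ h => h.2.1.third_le_eta h.1)
    ⟨isConnectedCubic_chordGraph, isBridgeless_of_isHamiltonian isHamiltonian_chordGraph,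
      isPlanar_chordGraph⟩
    isSparseMaximalMatching_chordGraph.eta_le

theorem classEtaEq_hamiltonianCubicGraphs : ClassEtaEq hamiltonianCubicGraphs (1 / 3) :=
  classEtaEq_of_forall (G := ⟨_, chordGraph⟩)
    (fun _ h => (isBridgeless_of_isHamiltonian h.2).third_le_eta h.1)
    ⟨isConnectedCubic_chordGraph, isHamiltonian_chordGraph⟩
    isSparseMaximalMatching_chordGraph.eta_le

theorem tripleLink_mem_bipartiteNonhamiltonianCubicGraphs :
    (⟨_, tripleLink⟩ : FinGraph) ∈ bipartiteNonhamiltonianCubicGraphs :=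
  ⟨isConnectedCubic_tripleLink, isBipartite_tripleLink, not_isHamiltonian_tripleLink⟩

theorem bipartiteNonhamiltonianCubicGraphs_subset_taitColorableGraphs :
    bipartiteNonhamiltonianCubicGraphs ⊆ taitColorableGraphs :=
  fun _ h => isTaitColorable_of_isBipartite h.1 h.2.1

theorem third_mem_lowerBounds_eta_bipartiteNonhamiltonianCubicGraphs :
    1 / 3 ∈ lowerBounds
      ((fun G : FinGraph => eta G.graph) '' bipartiteNonhamiltonianCubicGraphs) := by
  rintro _ ⟨G, hG, rfl⟩
  exact (bipartiteNonhamiltonianCubicGraphs_subset_taitColorableGraphs hG).third_le_eta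

end Classes

end CostOfPerfection

end

open CostOfPerfection in
theorem mainTheorem1 :
    ClassEtaEq taitColorableGraphs (1 / 3) ∧
    ClassEtaEq planarBridgelessCubicGraphs (1 / 3) ∧
    ClassEtaEq hamiltonianCubicGraphs (1 / 3) ∧
    ClassEtaEq generalizedPetersenGraphs (1 / 3) ∧
    (ClassEtaEq petersenSnarkFamily (1 / 3) ∧
      (∀ G ∈ petersenSnarkFamily, IsSnark G.graph ∧ eta G.graph = 1 / 3) ∧
      (∀ N : ℕ, ∃ G ∈ petersenSnarkFamily, N ≤ Fintype.card G.V)) ∧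
    (bipartiteNonhamiltonianCubicGraphs ⊆ taitColorableGraphs ∧
      1 / 3 ≤ classEta bipartiteNonhamiltonianCubicGraphs ∧
      classEta bipartiteNonhamiltonianCubicGraphs ≤ 1 / 2 ∧
      ∃ G ∈ bipartiteNonhamiltonianCubicGraphs, eta G.graph ≤ 1 / 2) := by
  have hsubset := bipartiteNonhamiltonianCubicGraphs_subset_taitColorableGraphs
  have hmem := tripleLink_mem_bipartiteNonhamiltonianCubicGraphs
  have hlower := third_mem_lowerBounds_eta_bipartiteNonhamiltonianCubicGraphs
  refine ⟨classEtaEq_taitColorableGraphs, classEtaEq_planarBridgelessCubicGraphs,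
    classEtaEq_hamiltonianCubicGraphs, classEtaEq_generalizedPetersenGraphs,
    ⟨classEtaEq_petersenSnarkFamily, fun _ h => isSnark_and_eta_of_mem_petersenSnarkFamily h,
      exists_mem_petersenSnarkFamily_card_ge⟩,
    hsubset, ?_, ?_, ⟨_, hmem, eta_tripleLink_le⟩⟩
  · exact le_csInf ⟨_, _, hmem, rfl⟩ hlower
  · exact (csInf_le ⟨_, hlower⟩ ⟨_, hmem, rfl⟩).trans eta_tripleLink_le
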